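/- Let $\mathbb A\in\{\mathbb R,\mathbb C,\mathbb H,\mathbb O\}$ be one of the four real normed division algebras, of real dimension $a\in\{1,2,4,8\}$, and let $\mathcal J_3(\mathbb O)$ be the Jordan algebra of $3\times 3$ octonionic Hermitian matrices, with subspace $\mathcal J_3(\mathbb O)_0$ of traceless matrices. Let $$\mathfrak g(\mathbb A,\mathbb O)=\big(\mathrm{Der}\,\mathbb A\times \mathrm{Der}\,\mathcal J_3(\mathbb O)\ \oplus\ \mathrm{Im}\,\mathbb A\otimes_{\mathbb R} \mathcal J_3(\mathbb O)_0\big)\otimes_{\mathbb R}\mathbb C$$ be the (complexified) Lie algebra given by the Tits–Freudenthal construction: $\mathrm{Der}\,\mathbb A\times\mathrm{Der}\,\mathcal J_3(\mathbb O)$ is a subalgebra acting naturally on $\mathrm{Im}\,\mathbb A\otimes\mathcal J_3(\mathbb O)_0$, and $$[u\otimes x,v\otimes y]=\tfrac13\mathrm{tr}(x\circ y)\,D_{u,v}+4\,\mathrm{Re}(uv)\,[L_x,L_y]+[u,v]\otimes\big(x\circ y-\tfrac13\mathrm{tr}(x\circ y)I\big),$$ where $x\circ y=\tfrac12(xy+yx)$,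 $L_x(y)=x\circ y$ and $D_{u,v}(w)=[[u,v],w]-3\big((uv)w-u(vw)\big)$. So $\mathfrak g(\mathbb A,\mathbb O)$ is $\mathfrak f_4,\mathfrak e_6,\mathfrak e_7,\mathfrak e_8$ for $a=1,2,4,8$, and it contains $\mathfrak f_4=\mathrm{Der}\,\mathcal J_3(\mathbb O)\otimes_{\mathbb R}\mathbb C$ as a subalgebra. For every $X\in\mathfrak f_4$, let $\mathcal O_a\subset\mathfrak g(\mathbb A,\mathbb O)$ be the orbit of $X$ under the adjoint group of $\mathfrak g(\mathbb A,\mathbb O)$ (the group generated by all $\exp(\mathrm{ad}\,Y)$, $Y\in\mathfrak g(\mathbb A,\mathbb O)$). Then $\mathcal O_a$ is an immersed complex submanifold whose complex dimension is a linear (i.e. affine) function of $a$: there are integers $\alpha,\beta$, depending only on $X$, such that $$\dim_{\mathbb C}\mathcal O_a=\alpha+\beta a\qquad\text{for } a=1,2,4,8.$$ -/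

import Mathlib

open scoped TensorProduct Quaternion Manifold ContDiff

attribute [local instance] LieRing.ofAssociativeRing

/-- The real octonions: Cayley-Dickson double of the quaternions. -/
@[ext]
structure Octonion where
  fst : ℍ[ℝ]
  snd : ℍ[ℝ]

namespace Octonion

/-- An octonion is a pair of quaternions. -/
def equivProd : Octonion ≃ ℍ[ℝ] × ℍ[ℝ] where
  toFun x := (x.fst, x.snd)
  invFun p := ⟨p.1, p.2⟩
  left_inv _ := rfl
  right_inv _ := rfl

noncomputable instance : AddCommGroup Octonion := equivProd.addCommGroup
noncomputable instance : Module ℝ Octonion := equivProd.module ℝ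

/-- The real-linear identification with pairs of quaternions. -/
noncomputable def linearEquivProd : Octonion ≃ₗ[ℝ] ℍ[ℝ] × ℍ[ℝ] := equivProd.linearEquiv ℝ

@[simp] theorem fst_zero : (0 : Octonion).fst = 0 := rfl
@[simp] theorem snd_zero : (0 : Octonion).snd = 0 := rfl
@[simp] theorem fst_add (x y : Octonion) : (x + y).fst = x.fst + y.fst := rfl
@[simp] theorem snd_add (x y : Octonion) : (x + y).snd = x.snd + y.snd := rfl
@[simp] theorem fst_smul (r : ℝ) (x : Octonion) : (r • x).fst = r • x.fst := rfl
@[simp] theorem snd_smul (r : ℝ) (x : Octonion) : (r • x).snd = r • x.snd := rfl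

noncomputable instance : One Octonion := ⟨⟨1, 0⟩⟩
noncomputable instance : Mul Octonion :=
  ⟨fun x y => ⟨x.fst * y.fst - star y.snd * x.snd, y.snd * x.fst + x.snd * star y.fst⟩⟩
noncomputable instance : Star Octonion := ⟨fun x => ⟨star x.fst, -x.snd⟩⟩

@[simp] theorem fst_one : (1 : Octonion).fst = 1 := rfl
@[simp] theorem snd_one : (1 : Octonion).snd = 0 := rfl
@[simp] theorem fst_mul (x y : Octonion) :
    (x * y).fst = x.fst * y.fst - star y.snd * x.snd := rfl
@[simp] theorem snd_mul (x y : Octonion) :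
    (x * y).snd = y.snd * x.fst + x.snd * star y.fst := rfl
@[simp] theorem fst_star (x : Octonion) : (star x).fst = star x.fst := rfl
@[simp] theorem snd_star (x : Octonion) : (star x).snd = -x.snd := rfl

noncomputable instance : NonAssocRing Octonion :=
  { (inferInstance : AddCommGroup Octonion), (inferInstance : Mul Octonion),
    (inferInstance : One Octonion) with
    left_distrib := fun x y z => by
      ext1 <;> simp only [fst_mul, snd_mul, fst_add, snd_add, star_add] <;> noncomm_ring
    right_distrib := fun x y z => by
      ext1 <;> simp only [fst_mul, snd_mul, fst_add, snd_add] <;> noncomm_ring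
    zero_mul := fun x => by ext1 <;> simp
    mul_zero := fun x => by ext1 <;> simp
    one_mul := fun x => by ext1 <;> simp
    mul_one := fun x => by ext1 <;> simp }

noncomputable instance : StarRing Octonion where
  star_involutive x := by ext1 <;> simp
  star_mul x y := by
    ext1 <;> simp only [fst_mul, snd_mul, fst_star, snd_star, star_sub, star_mul,
      star_star, star_neg] <;> noncomm_ring
  star_add x y := by ext1 <;> simp [add_comm]

instance : IsScalarTower ℝ Octonion Octonion where
  smul_assoc r x y := by
    ext1 <;> simp [smul_sub, smul_add]

instance : SMulCommClass ℝ Octonion Octonion where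
  smul_comm r x y := by
    ext1 <;> simp [smul_sub, smul_add]

instance : StarModule ℝ Octonion where
  star_smul r x := by ext1 <;> simp

instance : Module.Finite ℝ Octonion :=
  Module.Finite.equiv linearEquivProd.symm

end Octonion

/-- Finite-dimensional alternative unital real algebras with a conjugation `star` such that
`a + star a` is a real number `2 re a` and `re (star a * a)` is a positive definite quadratic form
(the norm). Instances are given below for `ℝ`, `ℂ`, the quaternions and the octonions (which are
the only examples, besides the zero ring excluded by `re_one`). The Tits construction is written
uniformly over this class so that its bracket is checked once for the four algebras. -/
class RealNormedAlgebra (A : Type) [NonAssocRing A] [StarRing A] [Module ℝ A]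
    extends IsScalarTower ℝ A A, SMulCommClass ℝ A A, StarModule ℝ A, Module.Finite ℝ A where
  re : A →ₗ[ℝ] ℝ
  re_one : re 1 = 1
  add_star : ∀ a : A, a + star a = (2 * re a) • (1 : A)
  re_star_mul_self_pos : ∀ a : A, a ≠ 0 → 0 < re (star a * a)
  mul_mul_self : ∀ a b : A, a * (a * b) = a * a * b

namespace RealNormedAlgebra

noncomputable instance : RealNormedAlgebra ℝ where
  re := LinearMap.id
  re_one := rfl
  add_star a := by simp; ring
  re_star_mul_self_pos a ha := by simpa using mul_self_pos.mpr ha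
  mul_mul_self a b := by ring

noncomputable instance : RealNormedAlgebra ℂ where
  re := Complex.reLm
  re_one := by simp
  add_star a := by apply Complex.ext <;> simp; ring
  re_star_mul_self_pos a ha := by
    have := Complex.normSq_pos.mpr ha
    simpa [Complex.normSq_apply] using this
  mul_mul_self a b := by ring

/-- The real part of a quaternion. -/
def quaternionRe : ℍ[ℝ] →ₗ[ℝ] ℝ where
  toFun a := a.re
  map_add' _ _ := rfl
  map_smul' _ _ := rfl

noncomputable instance : RealNormedAlgebra ℍ[ℝ] where
  star_smul r a := by simp
  re := quaternionRe
  re_one := rfl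
  add_star a := by
    change _ = (2 * a.re) • _
    ext <;> simp; ring
  re_star_mul_self_pos a ha := by
    change 0 < (star a * a).re
    have h : 0 < Quaternion.normSq a :=
      lt_of_le_of_ne Quaternion.normSq_nonneg (Ne.symm (Quaternion.normSq_ne_zero.mpr ha))
    rw [Quaternion.normSq_def'] at h
    simp; linarith
  mul_mul_self a b := by noncomm_ring

noncomputable instance : RealNormedAlgebra Octonion where
  re := quaternionRe.comp
    ((LinearMap.fst ℝ _ _).comp Octonion.linearEquivProd.toLinearMap)
  re_one := by
    change (1 : ℍ[ℝ]).re = 1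
    simp
  add_star a := by
    change _ = (2 * a.fst.re) • _
    ext <;> simp; ring
  re_star_mul_self_pos a ha := by
    change 0 < (star a * a).fst.re
    have h : 0 < Quaternion.normSq a.fst + Quaternion.normSq a.snd := by
      have h1 := Quaternion.normSq_nonneg (a := a.fst)
      have h2 := Quaternion.normSq_nonneg (a := a.snd)
      rcases lt_or_eq_of_le (add_nonneg h1 h2) with h | h
      · exact h
      · exfalso; apply ha
        have h3 : Quaternion.normSq a.fst = 0 := by linarith
        have h4 : Quaternion.normSq a.snd = 0 := by linarith
        ext1
        · exact Quaternion.normSq_eq_zero.mp h3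
        · exact Quaternion.normSq_eq_zero.mp h4
    rw [Quaternion.normSq_def', Quaternion.normSq_def'] at h
    simp; linarith
  mul_mul_self a b := by
    ext <;> simp <;> ring

end RealNormedAlgebra

namespace RealNormedAlgebra

section basic
variable {A : Type} [NonAssocRing A] [StarRing A] [Module ℝ A] [RealNormedAlgebra A]

/-- The commutator. -/
def brac (a b : A) : A := a * b - b * a

theorem star_eq (a : A) : star a = (2 * re a) • (1 : A) - a :=
  eq_sub_of_add_eq' (add_star a)

theorem re_star (a : A) : re (star a) = re a := by
  rw [star_eq, map_sub, map_smul, re_one, smul_eq_mul]; ring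

theorem re_mul_comm (a b : A) : re (a * b) = re (b * a) := by
  rw [← re_star (a * b), star_mul, star_eq a, star_eq b]
  simp only [mul_sub, sub_mul, smul_mul_assoc, mul_smul_comm, one_mul, mul_one, map_sub, map_smul,
    re_one, smul_eq_mul]
  ring

theorem assoc_left (a b c : A) :
    (a * b * c - a * (b * c)) + (b * a * c - b * (a * c)) = 0 := by
  have h := mul_mul_self (a + b) c
  have h1 := mul_mul_self a c
  have h2 := mul_mul_self b c
  simp only [add_mul, mul_add] at h
  linear_combination (norm := module) h1 + h2 - h

theorem mul_mul_self_right (a b : A) : (b * a) * a = b * (a * a) := by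
  have h := congrArg star (mul_mul_self (star a) (star b))
  simpa using h

theorem assoc_right (a b c : A) :
    (a * b * c - a * (b * c)) + (a * c * b - a * (c * b)) = 0 := by
  have h := mul_mul_self_right (b + c) a
  have h1 := mul_mul_self_right b a
  have h2 := mul_mul_self_right c a
  simp only [add_mul, mul_add] at h
  linear_combination (norm := module) h - h1 - h2

theorem re_mul_assoc (a b c : A) : re (a * b * c) = re (a * (b * c)) := by
  have h1 : star (a * b * c - a * (b * c)) = c * b * a - c * (b * a) := by
    rw [star_sub, star_mul, star_mul, star_mul, star_mul]
    simp only [star_eq, mul_sub, sub_mul, smul_mul_assoc, mul_smul_comm,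
      one_mul, mul_one]
    module
  have h2 : (c * b * a - c * (b * a)) = - (a * b * c - a * (b * c)) := by
    linear_combination (norm := module)
      assoc_left c b a - assoc_right b c a + assoc_left b a c
  have h3 := re_star (a * b * c - a * (b * c))
  rw [h1, h2] at h3
  simp only [map_neg, map_sub] at h3
  linarith

/-- The inner derivation `D_{a,b}`. -/
def innerDeriv (a b c : A) : A := brac (brac a b) c - (3 : ℝ) • (a * b * c - a * (b * c))

theorem inner_mul (a b c d : A) : innerDeriv a b (c * d) = innerDeriv a b c * d + c * innerDeriv a b d := by
  have hl := @assoc_left A _ _ _ _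
  have hr := @assoc_right A _ _ _ _
  simp only [innerDeriv, brac]
  linear_combination (norm := skip)
      -hr c (a * b) d + (3 : ℝ) • hl c d (b * a) - (3 : ℝ) • hr d c (b * a) - hl c (a * b) d
      + (3 : ℝ) • hr (a * b) d c - (2 : ℝ) • hr c d (b * a) + (3 : ℝ) • hl a b (d * c)
      + hl (b * a) c d + (3 : ℝ) • congrArg (· * d) (hl b c a)
      - (3 : ℝ) • congrArg (· * d) (hr c b a) - (3 : ℝ) • congrArg (· * c) (hl b a d)
      + (3 : ℝ) • congrArg (b * ·) (hr c d a) - (3 : ℝ) • congrArg (b * ·) (hl c d a)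
      + (3 : ℝ) • congrArg (b * ·) (hr d a c) + (3 : ℝ) • hl b (c * a) d
      - (3 : ℝ) • hr b c (a * d) - (3 : ℝ) • congrArg (a * ·) (hr b c d)
      + (3 : ℝ) • hl d (b * a) c - (3 : ℝ) • congrArg (b * ·) (hl d a c)
      - (3 : ℝ) • hr a (b * d) c + (3 : ℝ) • hl a c (b * d) - (3 : ℝ) • hl a (b * c) d
  simp only [mul_add, add_mul, mul_sub, sub_mul, smul_mul_assoc, mul_smul_comm, mul_zero, zero_mul]
  module

theorem inner_comm_cyclic (a b c d : A) :
    innerDeriv (brac a b) c d + innerDeriv (brac b c) a d + innerDeriv (brac c a) b d = 0 := by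
  have hl := @assoc_left A _ _ _ _
  have hr := @assoc_right A _ _ _ _
  simp only [innerDeriv, brac]
  linear_combination (norm := skip)
      -(2 : ℝ) • congrArg (d * ·) (hl b a c) - congrArg (· * d) (hl a b c)
      - (3 : ℝ) • hr b (d * c) a + (3 : ℝ) • hl b (d * c) a - congrArg (d * ·) (hl b c a)
      - (3 : ℝ) • hl a (b * c) d - congrArg (· * d) (hr a b c)
      - (2 : ℝ) • congrArg (· * d) (hl c b a) + congrArg (d * ·) (hr a b c)
      + (3 : ℝ) • hl (c * b) a d + (3 : ℝ) • hr (c * d) a b - (3 : ℝ) • hr a d (c * b)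
      + (3 : ℝ) • hl a d (c * b) - (3 : ℝ) • congrArg (· * a) (hl c d b)
      - (3 : ℝ) • hr d (c * b) a + (3 : ℝ) • hl d c (b * a) - (3 : ℝ) • hl d (a * c) b
      + (3 : ℝ) • congrArg (· * b) (hl a c d) + (3 : ℝ) • hr d (a * c) b
      + (6 : ℝ) • hr a (c * d) b + (3 : ℝ) • hr c b (a * d) - (3 : ℝ) • hr (c * a) d b
      + (3 : ℝ) • congrArg (· * d) (hr b c a) - (3 : ℝ) • congrArg (a * ·) (hr b d c)
      + (3 : ℝ) • hr b c (a * d) + (3 : ℝ) • congrArg (b * ·) (hr a c d)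
      - (3 : ℝ) • hl c b (a * d) - (3 : ℝ) • hl b a (c * d) - (3 : ℝ) • hl (c * d) a b
      + (3 : ℝ) • congrArg (c * ·) (hl a d b) - (3 : ℝ) • congrArg (c * ·) (hr d a b)
      - congrArg (d * ·) (hr c b a) + congrArg (· * d) (hr c b a) - (3 : ℝ) • hl (d * b) c a
      + (3 : ℝ) • hr (d * b) c a - (3 : ℝ) • congrArg (· * c) (hl d b a)
      + (3 : ℝ) • congrArg (· * c) (hr b d a) - (3 : ℝ) • hl (b * a) d c
      + (3 : ℝ) • hl b (a * c) d + (3 : ℝ) • congrArg (a * ·) (hl c d b)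
      - (3 : ℝ) • congrArg (a * ·) (hr d c b) + (3 : ℝ) • congrArg (a * ·) (hl d b c)
      - (3 : ℝ) • hl c a (d * b)
  simp only [mul_add, add_mul, mul_sub, sub_mul, smul_mul_assoc, mul_smul_comm, mul_zero, zero_mul]
  module

theorem mul_comm_im (a b : A) (ha : star a = -a) (hb : star b = -b) :
    b * a = (2 * re (a * b)) • (1 : A) - a * b := by
  have h := add_star (a * b)
  rw [star_mul, ha, hb, neg_mul_neg] at h
  exact eq_sub_of_add_eq' h

theorem brac_brac_im (a b c : A) (ha : star a = -a) (hb : star b = -b) (hc : star c = -c) :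
    brac (brac a b) c = (4 * re (b * c)) • a - (4 * re (c * a)) • b
      + (2 : ℝ) • (a * b * c - a * (b * c)) := by
  have e1 := congrArg (· * c) (mul_comm_im a b ha hb)
  have e2 := congrArg (c * ·) (mul_comm_im a b ha hb)
  have e3 := congrArg (· * b) (mul_comm_im a c ha hc)
  have e4 := congrArg (a * ·) (mul_comm_im b c hb hc)
  have f1 := assoc_left a c b
  have f3 : re (c * a) = re (a * c) := re_mul_comm _ _
  simp only [mul_sub, sub_mul, smul_mul_assoc, mul_smul_comm, one_mul, mul_one] at e1 e2 e3 e4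
  simp only [brac, mul_sub, sub_mul, f3]
  linear_combination (norm := module)
    -e1 + e2 + (2 : ℝ) • f1 - (2 : ℝ) • e3 + (2 : ℝ) • e4

theorem re_eq_zero_iff (a : A) : star a = -a ↔ re a = 0 := by
  constructor
  · intro h
    have := re_star a
    rw [h, map_neg] at this
    linarith
  · intro h
    rw [star_eq, h]; simp

end basic

end RealNormedAlgebra

/-- Derivations of a bilinear product. -/
def derivationAlgebra {V : Type} [AddCommGroup V] [Module ℝ V] (m : V →ₗ[ℝ] V →ₗ[ℝ] V) :
    LieSubalgebra ℝ (Module.End ℝ V) where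
  carrier := {D | ∀ x y, D (m x y) = m (D x) y + m x (D y)}
  add_mem' {D E} hD hE x y := by
    simp only [Set.mem_ofPred_eq] at hD hE
    simp only [LinearMap.add_apply, hD, hE, map_add]
    abel
  zero_mem' x y := by simp
  smul_mem' r D hD x y := by
    simp only [Set.mem_ofPred_eq] at hD
    simp only [LinearMap.smul_apply, hD, map_smul, smul_add]
  lie_mem' {D E} hD hE x y := by
    simp only [Set.mem_ofPred_eq] at hD hE
    simp only [LieRing.of_associative_ring_bracket, LinearMap.sub_apply, Module.End.mul_apply,
      hD, hE, map_add, map_sub]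
    abel

theorem derivationAlgebra_apply {V : Type} [AddCommGroup V] [Module ℝ V]
    {m : V →ₗ[ℝ] V →ₗ[ℝ] V} (D : derivationAlgebra m) (x y : V) :
    (D : Module.End ℝ V) (m x y) =
      m ((D : Module.End ℝ V) x) y + m x ((D : Module.End ℝ V) y) := D.2 x y

section cubic
variable {V : Type} [AddCommGroup V] [Module ℝ V] {m : V →ₗ[ℝ] V →ₗ[ℝ] V} {e : V}
  {T : V →ₗ[ℝ] ℝ}

/-- Commutative algebras with an associative trace satisfying a generic cubic equation. -/
structure IsCubic (m : V →ₗ[ℝ] V →ₗ[ℝ] V) (e : V) (T : V →ₗ[ℝ] ℝ) : Prop where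
  comm : ∀ x y, m x y = m y x
  one : ∀ x, m e x = x
  trace_one : T e = 3
  assoc : ∀ x y z, T (m (m x y) z) = T (m x (m y z))
  cubic : ∀ x, ∃ ν : ℝ,
    m (m x x) x - T x • m x x + ((T x ^ 2 - T (m x x)) / 2) • x = ν • e

theorem IsCubic.polar (h : IsCubic m e T) (x y : V) :
    (2 : ℝ) • m x (m x y) + m (m x x) y - (2 * T x) • m x y - T y • m x x
      + (T x * T y - T (m x y)) • x + ((T x ^ 2 - T (m x x)) / 2) • y
      = (T (m (m x x) y) - T x * T (m x y) + ((T x ^ 2 - T (m x x)) / 2) * T y) • e := by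
  have key : ∃ ν : ℝ, (2 : ℝ) • m x (m x y) + m (m x x) y - (2 * T x) • m x y - T y • m x x
      + (T x * T y - T (m x y)) • x + ((T x ^ 2 - T (m x x)) / 2) • y = ν • e := by
    obtain ⟨n1, h1⟩ := h.cubic (x + y)
    obtain ⟨n2, h2⟩ := h.cubic (x - y)
    obtain ⟨n3, h3⟩ := h.cubic y
    have c1 := h.comm y x
    have c2 := h.comm (m x y) x
    refine ⟨(1 / 2) * (n1 - n2) - n3, ?_⟩
    simp only [map_add, map_sub, LinearMap.add_apply, LinearMap.sub_apply, c1, c2] at h1 h2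
    linear_combination (norm := module) (1 / 2 : ℝ) • h1 - (1 / 2 : ℝ) • h2 - h3
  obtain ⟨ν, hν⟩ := key
  have hT := congrArg T hν
  simp only [map_add, map_sub, map_smul, smul_eq_mul, h.trace_one] at hT
  have h4 : T (m x (m x y)) = T (m (m x x) y) := (h.assoc x x y).symm
  rw [h4] at hT
  have : ν = (T (m (m x x) y) - T x * T (m x y) + ((T x ^ 2 - T (m x x)) / 2) * T y) := by
    linarith
  rw [hν, this]

theorem IsCubic.jordan (h : IsCubic m e T) (x y : V) :
    m (m x x) (m x y) = m x (m (m x x) y) := by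
  have h1 := congrArg (m x) (h.polar x y)
  have h2 := h.polar x (m x y)
  obtain ⟨ν, h3⟩ := h.cubic x
  have h3T := congrArg (fun z => T (m z y)) h3
  have c1 : m x (m x x) = m (m x x) x := h.comm _ _
  have c2 : m x e = x := by rw [h.comm, h.one]
  have a1 : T (m (m x x) (m x y)) = T (m (m (m x x) x) y) := (h.assoc _ _ _).symm
  have a2 : T (m x (m x y)) = T (m (m x x) y) := (h.assoc x x y).symm
  simp only [map_add, map_sub, map_smul, LinearMap.add_apply, LinearMap.sub_apply,
    LinearMap.smul_apply, smul_eq_mul, h.one] at h3T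
  simp only [map_add, map_sub, map_smul, c1, c2] at h1
  rw [a1, a2] at h2
  have h4 : T (m (m (m x x) x) y) = ν * T y + T x * T (m (m x x) y)
    - (T x ^ 2 - T (m x x)) / 2 * T (m x y) := by linarith
  rw [h4] at h2
  linear_combination (norm := module) h2 - h1 - T y • h3

theorem IsCubic.jordan_polar (h : IsCubic m e T) (x z w y : V) :
    m (m x z) (m w y) + m (m z w) (m x y) + m (m w x) (m z y)
      = m x (m (m z w) y) + m z (m (m w x) y) + m w (m (m x z) y) := by
  have c1 := h.comm z x
  have c2 := h.comm w x
  have c3 := h.comm w z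
  have j1 := h.jordan (x + z + w) y
  have j2 := h.jordan (x + z) y
  have j3 := h.jordan (x + w) y
  have j4 := h.jordan (z + w) y
  have j5 := h.jordan x y
  have j6 := h.jordan z y
  have j7 := h.jordan w y
  simp only [map_add, LinearMap.add_apply, c1, c2, c3] at j1 j2 j3 j4 ⊢
  linear_combination (norm := module) (1 / 2 : ℝ) • (j1 - j2 - j3 - j4 + j5 + j6 + j7)

theorem IsCubic.inner_deriv (h : IsCubic m e T) (x y z w : V) :
    m x (m y (m z w)) - m y (m x (m z w)) =
      m (m x (m y z) - m y (m x z)) w + m z (m x (m y w) - m y (m x w)) := by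
  have h1 := h.jordan_polar x z w y
  have h2 := h.jordan_polar y z w x
  have h3 := h.comm
  rw [h3 (m z w) y, h3 (m w x) y, h3 (m x z) y, h3 w x, h3 w y, h3 z y] at h1
  rw [h3 (m z w) x, h3 (m w y) x, h3 (m y z) x, h3 w y, h3 w x, h3 z x, h3 y x] at h2
  rw [map_sub, map_sub, LinearMap.sub_apply, h3 (m x (m y z)) w, h3 (m y (m x z)) w]
  rw [h3 y z] at *
  rw [h3 (m z w) (m x y)] at *
  rw [h3 (m z y) (m x w), h3 (m y w) (m x z)] at h2
  linear_combination (norm := module) h2 - h1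

theorem IsCubic.cyclic (h : IsCubic m e T) (x z w y : V) :
    (m (m x z) (m w y) - m w (m (m x z) y)) + (m (m z w) (m x y) - m x (m (m z w) y))
      + (m (m w x) (m z y) - m z (m (m w x) y)) = 0 := by
  linear_combination (norm := module) h.jordan_polar x z w y

theorem IsCubic.polar_zero (h : IsCubic m e T) (x y z : V)
    (hx : T x = 0) (hy : T y = 0) (hz : T z = 0) :
    (2 : ℝ) • (m (m x y) z + m (m y z) x + m (m z x) y)
      = T (m x y) • z + T (m y z) • x + T (m z x) • y + (2 * T (m (m x y) z)) • e := by
  have p1 := h.polar (x + y) z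
  have p2 := h.polar x z
  have p3 := h.polar y z
  have c1 := h.comm y x
  have c2 : m z x = m x z := h.comm _ _
  have c3 : m (m y z) x = m x (m y z) := h.comm _ _
  have c4 : m (m x z) y = m y (m x z) := h.comm _ _
  simp only [map_add, LinearMap.add_apply, hx, hy, hz, c1, c2, c3, c4] at p1 p2 p3 ⊢
  linear_combination (norm := module) p1 - p2 - p3

theorem IsCubic.trace_deriv (h : IsCubic m e T) (d : V →ₗ[ℝ] V)
    (hd : ∀ x y, d (m x y) = m (d x) y + m x (d y)) (x : V) :
    ∃ s n : ℝ, T (d x) • m x x = s • x + n • e := by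
  have he : d e = 0 := by
    have := hd e e
    rw [h.one, h.comm (d e) e, h.one] at this
    simpa using this
  obtain ⟨ν, h1⟩ := h.cubic x
  have h2 := congrArg d h1
  have h3 := h.polar x (d x)
  have c1 : m (d x) x = m x (d x) := h.comm _ _
  have c2 : m (m x (d x)) x = m x (m x (d x)) := h.comm _ _
  simp only [map_add, map_sub, map_smul, hd, he, LinearMap.add_apply, c1, c2] at h2
  refine ⟨T x * T (d x) - T (m x (d x)), -(T (m (m x x) (d x)) - T x * T (m x (d x))
    + ((T x ^ 2 - T (m x x)) / 2) * T (d x)), ?_⟩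
  linear_combination (norm := module) h2 - h3

end cubic

section hermitian
open RealNormedAlgebra
variable {B : Type} [NonAssocRing B] [StarRing B] [Module ℝ B] [RealNormedAlgebra B]

namespace RealNormedAlgebra

theorem eq_re_of_star (a : B) (h : star a = a) : a = re a • (1 : B) := by
  have h1 := add_star a
  rw [h] at h1
  linear_combination (norm := module) (1 / 2 : ℝ) • h1

/-- The squared norm `a a^*`, as a real number. -/
def normSq (a : B) : ℝ := re (a * star a)

theorem mul_star_eq (a : B) : a * star a = normSq a • (1 : B) :=
  eq_re_of_star _ (by rw [star_mul, star_star])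

theorem star_mul_eq (a : B) : star a * a = normSq a • (1 : B) := by
  rw [normSq, re_mul_comm]
  exact eq_re_of_star _ (by rw [star_mul, star_star])

theorem normSq_star (a : B) : normSq (star a) = normSq a := by
  rw [normSq, normSq, star_star, re_mul_comm]

theorem star_mul_mul (a b : B) : star a * (a * b) = normSq a • b := by
  have h := mul_mul_self a b
  have h2 := congrArg (· * b) (star_mul_eq a)
  simp only [star_eq, sub_mul, smul_mul_assoc, one_mul] at h h2 ⊢
  rw [h]
  linear_combination (norm := module) h2

theorem mul_star_mul (a b : B) : a * (star a * b) = normSq a • b := by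
  have h := star_mul_mul (star a) b
  rwa [star_star, normSq_star] at h

theorem mul_mul_star (a b : B) : b * a * star a = normSq a • b := by
  have h := congrArg star (mul_star_mul a (star b))
  simpa using h

theorem mul_star_mul' (a b : B) : b * star a * a = normSq a • b := by
  have h := mul_mul_star (star a) b
  rwa [star_star, normSq_star] at h

end RealNormedAlgebra

/-- Hermitian `3 × 3` matrices with coefficients in `B`. -/
@[ext]
structure J3 (B : Type) [NonAssocRing B] [StarRing B] where
  val : Matrix (Fin 3) (Fin 3) B
  star_val : star val = val

namespace J3

/-- Hermitian matrices as a subspace of the space of all matrices. -/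
def equivSubmodule : J3 B ≃ selfAdjoint.submodule ℝ (Matrix (Fin 3) (Fin 3) B) where
  toFun x := ⟨x.1, x.2⟩
  invFun x := ⟨x.1, x.2⟩
  left_inv _ := rfl
  right_inv _ := rfl

noncomputable instance : AddCommGroup (J3 B) := equivSubmodule.addCommGroup

noncomputable instance : Module ℝ (J3 B) := equivSubmodule.module ℝ

/-- The underlying matrix. -/
noncomputable def toMatrix : J3 B →ₗ[ℝ] Matrix (Fin 3) (Fin 3) B :=
  (selfAdjoint.submodule ℝ (Matrix (Fin 3) (Fin 3) B)).subtype ∘ₗ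
    (equivSubmodule.linearEquiv ℝ).toLinearMap

theorem coe_add (x y : J3 B) : (x + y).1 = x.1 + y.1 := rfl
theorem coe_sub (x y : J3 B) : (x - y).1 = x.1 - y.1 := rfl
theorem coe_smul (r : ℝ) (x : J3 B) : (r • x).1 = r • x.1 := rfl


/-- The Jordan product `(xy + yx) / 2`. -/
noncomputable def jordan : J3 B →ₗ[ℝ] J3 B →ₗ[ℝ] J3 B :=
  LinearMap.mk₂ ℝ (fun x y => ⟨(1 / 2 : ℝ) • (x.1 * y.1 + y.1 * x.1), by
      have hx : star x.1 = x.1 := x.2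
      have hy : star y.1 = y.1 := y.2
      rw [star_smul, star_add, star_mul, star_mul, hx, hy, add_comm, star_trivial]⟩)
    (fun x y z => J3.ext (by
      change (1 / 2 : ℝ) • ((x.1 + y.1) * z.1 + z.1 * (x.1 + y.1))
        = (1 / 2 : ℝ) • (x.1 * z.1 + z.1 * x.1) + (1 / 2 : ℝ) • (y.1 * z.1 + z.1 * y.1)
      simp only [add_mul, mul_add]; module))
    (fun r x y => J3.ext (by
      change (1 / 2 : ℝ) • ((r • x.1) * y.1 + y.1 * (r • x.1))
        = r • (1 / 2 : ℝ) • (x.1 * y.1 + y.1 * x.1)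
      simp only [smul_mul_assoc, mul_smul_comm]; module))
    (fun x y z => J3.ext (by
      change (1 / 2 : ℝ) • (x.1 * (y.1 + z.1) + (y.1 + z.1) * x.1)
        = (1 / 2 : ℝ) • (x.1 * y.1 + y.1 * x.1) + (1 / 2 : ℝ) • (x.1 * z.1 + z.1 * x.1)
      simp only [add_mul, mul_add]; module))
    (fun r x y => J3.ext (by
      change (1 / 2 : ℝ) • (x.1 * (r • y.1) + (r • y.1) * x.1)
        = r • (1 / 2 : ℝ) • (x.1 * y.1 + y.1 * x.1)
      simp only [smul_mul_assoc, mul_smul_comm]; module))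

theorem coe_jordan (x y : J3 B) : (jordan x y).1 =
    (1 / 2 : ℝ) • (x.1 * y.1 + y.1 * x.1) := rfl

/-- The trace. -/
noncomputable def trace : J3 B →ₗ[ℝ] ℝ :=
  re ∘ₗ Matrix.traceLinearMap (Fin 3) ℝ B ∘ₗ toMatrix

theorem trace_apply (x : J3 B) : trace x = re (Matrix.trace x.1) := rfl

/-- The identity matrix. -/
def one : J3 B := ⟨1, star_one _⟩

theorem re_trace_mul_comm (M N : Matrix (Fin 3) (Fin 3) B) :
    re (Matrix.trace (M * N)) = re (Matrix.trace (N * M)) := by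
  simp only [Matrix.trace, Matrix.diag, Matrix.mul_apply, map_sum]
  rw [Finset.sum_comm]
  simp only [re_mul_comm]

theorem re_trace_mul_assoc (M N P : Matrix (Fin 3) (Fin 3) B) :
    re (Matrix.trace (M * N * P)) = re (Matrix.trace (M * (N * P))) := by
  simp only [Matrix.trace, Matrix.diag, Matrix.mul_apply, map_sum, Finset.sum_mul, Finset.mul_sum,
    re_mul_assoc]
  refine Finset.sum_congr rfl fun i _ => ?_
  rw [Finset.sum_comm]

theorem trace_assoc (x y z : J3 B) :
    trace (jordan (jordan x y) z) = trace (jordan x (jordan y z)) := by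
  have h1 := re_trace_mul_assoc (B := B)
  have h2 := re_trace_mul_comm (B := B)
  simp only [trace_apply, coe_jordan, mul_add, add_mul, smul_mul_assoc, mul_smul_comm,
    Matrix.trace_add, Matrix.trace_smul, map_add, map_smul, smul_eq_mul]
  rw [h2 z.1 (x.1 * y.1), h2 z.1 (y.1 * x.1), h2 (y.1 * z.1) x.1, h2 (z.1 * y.1) x.1,
    h1 x.1 y.1 z.1, h2 (y.1 * x.1) z.1, ← h1 z.1 y.1 x.1, h2 (z.1 * y.1) x.1]

theorem trace_one : trace (one : J3 B) = 3 := by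
  change re (Matrix.trace (1 : Matrix (Fin 3) (Fin 3) B)) = 3
  simp only [Matrix.trace, Fin.sum_univ_three, Matrix.diag, Matrix.one_apply_eq,
    map_add, re_one]
  norm_num

theorem jordan_comm (x y : J3 B) : jordan x y = jordan y x := by
  apply J3.ext
  rw [coe_jordan, coe_jordan, add_comm]

theorem one_jordan (x : J3 B) : jordan one x = x := by
  apply J3.ext
  rw [coe_jordan]
  change (1 / 2 : ℝ) • (1 * x.1 + x.1 * 1) = x.1
  simp only [one_mul, mul_one]
  module

theorem star_apply (x : J3 B) (i j : Fin 3) : star (x.1 j i) = x.1 i j :=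
  congrFun (congrFun (show star x.1 = x.1 from x.2) i) j

theorem vec_two {α : Type} (x y z : α) : ![x, y, z] 2 = z := rfl

/-- The Hermitian matrix with given entries. -/
def mat (α β γ : ℝ) (a b c : B) : Matrix (Fin 3) (Fin 3) B :=
  !![α • 1, c, star b; star c, β • 1, a; b, star a, γ • 1]

theorem eq_mat (x : J3 B) : x.1 = mat (re (x.1 0 0)) (re (x.1 1 1)) (re (x.1 2 2))
    (x.1 1 2) (x.1 2 0) (x.1 0 1) := by
  have h0 : x.1 0 0 = re (x.1 0 0) • (1 : B) := eq_re_of_star _ (star_apply x 0 0)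
  have h1 : x.1 1 1 = re (x.1 1 1) • (1 : B) := eq_re_of_star _ (star_apply x 1 1)
  have h2 : x.1 2 2 = re (x.1 2 2) • (1 : B) := eq_re_of_star _ (star_apply x 2 2)
  rw [mat, ← h0, ← h1, ← h2, star_apply, star_apply, star_apply]
  exact Matrix.eta_fin_three _

theorem mat_mul_mat (α β γ : ℝ) (a b c : B) : mat α β γ a b c * mat α β γ a b c =
    mat (α ^ 2 + normSq b + normSq c) (β ^ 2 + normSq c + normSq a)
      (γ ^ 2 + normSq a + normSq b) ((β + γ) • a + star c * star b)
      ((γ + α) • b + star a * star c) ((α + β) • c + star b * star a) := by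
  rw [mat, Matrix.mul_fin_three, mat]
  simp only [star_add, star_mul, star_star, star_smul, star_trivial, smul_mul_assoc, mul_smul_comm,
    one_mul, mul_one, mul_star_eq, star_mul_eq]
  ext i j
  fin_cases i <;> fin_cases j <;> dsimp [-Matrix.cons_val, vec_two] <;> module

theorem cubic (x : J3 B) : ∃ ν : ℝ,
    jordan (jordan x x) x - trace x • jordan x x +
      ((trace x ^ 2 - trace (jordan x x)) / 2) • x = ν • one := by
  obtain ⟨α, β, γ, a, b, c, hx⟩ : ∃ α β γ a b c, x.1 = mat α β γ a b c :=
    ⟨_, _, _, _, _, _, eq_mat x⟩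
  have hxx : (jordan x x).1 = x.1 * x.1 := by rw [coe_jordan]; module
  have ht : trace x = α + β + γ := by
    simp [trace_apply, hx, mat, Matrix.trace_fin_three, re_one]
  have ht2 : trace (jordan x x) = α ^ 2 + β ^ 2 + γ ^ 2 +
      2 * (normSq a + normSq b + normSq c) := by
    rw [trace_apply, hxx, hx, mat_mul_mat]
    simp only [mat, Matrix.trace_fin_three_of, map_add, map_smul, re_one, smul_eq_mul]
    ring
  have r1 : re (c * (a * b)) = re (c * a * b) := (re_mul_assoc _ _ _).symm
  have r2 : re (a * (b * c)) = re (c * a * b) := by rw [← re_mul_assoc, re_mul_comm, r1]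
  have r3 : re (a * b * c) = re (c * a * b) := by rw [re_mul_comm, r1]
  have r4 : re (b * (c * a)) = re (c * a * b) := re_mul_comm _ _
  have r5 : re (b * c * a) = re (c * a * b) := by rw [re_mul_assoc, r4]
  have s0 := add_star (c * a * b)
  have s1 := add_star (c * (a * b))
  have s2 := add_star (a * (b * c))
  have s3 := add_star (a * b * c)
  have s4 := add_star (b * (c * a))
  have s5 := add_star (b * c * a)
  rw [r1] at s1
  rw [r2] at s2
  rw [r3] at s3
  rw [r4] at s4
  rw [r5] at s5
  simp only [star_mul] at s0 s1 s2 s3 s4 s5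
  refine ⟨α * β * γ - α * normSq a - β * normSq b - γ * normSq c
    + 2 * re (c * a * b), J3.ext ?_⟩
  rw [ht, ht2]
  simp only [coe_add, coe_sub, coe_smul]
  rw [coe_jordan, hxx, hx, mat_mul_mat]
  simp only [mat, one, Matrix.mul_fin_three, Matrix.one_fin_three, Matrix.smul_of]
  simp only [star_add, star_mul, star_star, star_smul, star_trivial, smul_mul_assoc, mul_smul_comm,
    one_mul, mul_one, mul_add, add_mul, mul_star_eq, star_mul_eq, star_mul_mul, mul_star_mul,
    mul_mul_star, mul_star_mul']
  ext i j
  fin_cases i <;> fin_cases j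
  all_goals dsimp [-Matrix.cons_val, vec_two]
  · linear_combination (norm := module) (1 / 2 : ℝ) • (s0 + s1)
  · module
  · module
  · module
  · linear_combination (norm := module) (1 / 2 : ℝ) • (s2 + s3)
  · module
  · module
  · module
  · linear_combination (norm := module) (1 / 2 : ℝ) • (s4 + s5)

end J3
end hermitian

section coordinates
open RealNormedAlgebra
variable (A : Type) [NonAssocRing A] [StarRing A] [Module ℝ A] [RealNormedAlgebra A]

/-- The Lie algebra of derivations of `A`. -/
abbrev DerA : LieSubalgebra ℝ (Module.End ℝ A) := derivationAlgebra (LinearMap.mul ℝ A)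

/-- The imaginary part. -/
abbrev Im : Submodule ℝ A := skewAdjoint.submodule ℝ A

/-- The Lie algebra of derivations of the Jordan algebra `J3 B`. -/
noncomputable abbrev DerJ : LieSubalgebra ℝ (Module.End ℝ (J3 A)) := derivationAlgebra (J3.jordan (B := A))

/-- Traceless Hermitian matrices. -/
noncomputable abbrev J30 : Submodule ℝ (J3 A) := LinearMap.ker (J3.trace (B := A))

variable {A}

theorem Im.star_eq_neg (a : Im A) : star (a : A) = -a := a.2

theorem derA_mul (D : DerA A) (a b : A) : D.1 (a * b) = D.1 a * b + a * D.1 b := D.2 a b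

theorem derA_one (D : DerA A) : D.1 1 = 0 := by
  have := derA_mul D 1 1
  simpa using this

theorem re_derA (D : DerA A) (a : A) : re (D.1 a) = 0 := by
  set u : A := a - re a • (1 : A) with hu
  have hDu : D.1 u = D.1 a := by rw [hu, map_sub, map_smul, derA_one]; simp
  have hreu : re u = 0 := by rw [hu, map_sub, map_smul, re_one]; simp
  have hsu : star u = -u := (re_eq_zero_iff u).mpr hreu
  have huu : u * u = (-normSq u) • (1 : A) := by
    have := mul_star_eq u
    rw [hsu, mul_neg] at this
    rw [neg_smul, ← this, neg_neg]
  have h1 := congrArg D.1 huu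
  rw [derA_mul, map_smul, derA_one, smul_zero] at h1
  set w := D.1 u with hw
  set v : A := w - re w • (1 : A) with hv
  have hrev : re v = 0 := by rw [hv, map_sub, map_smul, re_one]; simp
  have h2 := mul_comm_im v u ((re_eq_zero_iff v).mpr hrev) hsu
  have hwv : w = v + re w • (1 : A) := by rw [hv]; abel
  rw [hwv, add_mul, mul_add, smul_mul_assoc, mul_smul_comm, one_mul, mul_one] at h1
  have h3 : (2 * re (v * u)) • (1 : A) + (2 * re w) • u = 0 := by
    rw [h2] at h1
    linear_combination (norm := module) h1
  have h4 := congrArg re h3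
  rw [map_add, map_smul, map_smul, re_one, hreu, map_zero] at h4
  have h5 : re (v * u) = 0 := by simpa using h4
  rw [h5, mul_zero, zero_smul, zero_add, smul_eq_zero] at h3
  rw [← hDu]
  rcases h3 with h | h
  · linarith
  · rw [hw, h, map_zero, map_zero]

theorem derA_im (D : DerA A) (a : A) : D.1 a ∈ Im A :=
  (re_eq_zero_iff _).mpr (re_derA D a)

theorem J3.isCubic : IsCubic (J3.jordan (B := A)) J3.one J3.trace where
  comm := J3.jordan_comm
  one := J3.one_jordan
  trace_one := J3.trace_one
  assoc := J3.trace_assoc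
  cubic := J3.cubic

theorem derJ_jordan (d : DerJ A) (x y : J3 A) :
    d.1 (J3.jordan x y) = J3.jordan (d.1 x) y + J3.jordan x (d.1 y) := d.2 x y

theorem trace_derJ (d : DerJ A) (x : J3 A) : J3.trace (d.1 x) = 0 := by
  let lam : Fin 3 → ℝ := ![1, -1, 0]
  set Λ : J3 A := ⟨Matrix.diagonal fun i => lam i • 1, by
    rw [Matrix.star_eq_conjTranspose, Matrix.diagonal_conjTranspose]
    congr 1
    funext i
    simp⟩ with hΛ
  -- the diagonal entries
  let δ : Fin 3 → J3 A →ₗ[ℝ] ℝ := fun i =>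
    { toFun := fun y => re (y.1 i i)
      map_add' := fun y z => by simp [J3.coe_add]
      map_smul' := fun r y => by simp [J3.coe_smul] }
  have hδ : ∀ i y, δ i y = re (y.1 i i) := fun _ _ => rfl
  have hone : ∀ i, δ i J3.one = 1 := fun i => by
    rw [hδ]
    simp only [J3.one, Matrix.one_apply_eq, re_one]
  have hL : ∀ i y, δ i (J3.jordan y Λ) = lam i * δ i y := by
    intro i y
    rw [hδ, hδ, J3.coe_jordan, hΛ, Matrix.smul_apply, Matrix.add_apply, Matrix.mul_diagonal,
      Matrix.diagonal_mul]
    simp only [mul_smul_comm, smul_mul_assoc, mul_one, one_mul, map_smul, map_add, smul_eq_mul]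
    ring
  have hLL : ∀ i, δ i Λ = lam i := by
    intro i
    have h : δ i Λ = re (Matrix.diagonal (fun i => lam i • (1 : A)) i i) := rfl
    rw [h, Matrix.diagonal_apply_eq, map_smul, re_one, smul_eq_mul, mul_one]
  have key : ∀ y : J3 A, J3.trace (d.1 y) *
      (δ 0 (J3.jordan y y) * (δ 1 y - δ 2 y) + δ 1 (J3.jordan y y) * (δ 2 y - δ 0 y)
        + δ 2 (J3.jordan y y) * (δ 0 y - δ 1 y)) = 0 := by
    intro y
    obtain ⟨s, n, h⟩ := J3.isCubic.trace_deriv d.1 (derJ_jordan d) y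
    have h0 := congrArg (δ 0) h
    have h1 := congrArg (δ 1) h
    have h2 := congrArg (δ 2) h
    simp only [map_add, map_smul, smul_eq_mul, hone] at h0 h1 h2
    linear_combination (δ 1 y - δ 2 y) * h0 + (δ 2 y - δ 0 y) * h1 + (δ 0 y - δ 1 y) * h2
  have key2 : ∀ s : ℝ, (J3.trace (d.1 x) + s * J3.trace (d.1 Λ)) *
      ((δ 0 (J3.jordan x x) + 2 * s * δ 0 x + s ^ 2) * (δ 1 x - s - δ 2 x)
        + (δ 1 (J3.jordan x x) - 2 * s * δ 1 x + s ^ 2) * (δ 2 x - (δ 0 x + s))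
        + δ 2 (J3.jordan x x) * (δ 0 x + s - (δ 1 x - s))) = 0 := by
    intro s
    have h := key (x + s • Λ)
    have hc : J3.jordan Λ x = J3.jordan x Λ := J3.jordan_comm _ _
    simp only [map_add, map_smul, LinearMap.add_apply, LinearMap.smul_apply, hc, hL, hLL,
      smul_eq_mul] at h
    simp only [lam, Matrix.cons_val_zero, Matrix.cons_val_one, J3.vec_two] at h
    linear_combination h
  have e0 := key2 0
  have e1 := key2 1
  have e2 := key2 (-1)
  have e3 := key2 2
  have e4 := key2 (-2)
  have hb : J3.trace (d.1 Λ) = 0 := by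
    linear_combination (-1 / 48) * (6 * e0 - 4 * e1 - 4 * e2 + e3 + e4)
  rw [hb] at e0 e1 e2 e3 e4
  linear_combination (-1 / 24) * (e3 - e4 - 2 * e1 + 2 * e2)

end coordinates

section maps
open RealNormedAlgebra
variable {A : Type} [NonAssocRing A] [StarRing A] [Module ℝ A] [RealNormedAlgebra A]

/-- The derivation `D_{a,b}`, bilinear in `a` and `b`. -/
def innerDerA : Im A →ₗ[ℝ] Im A →ₗ[ℝ] DerA A :=
  LinearMap.mk₂ ℝ
    (fun a b => ⟨{ toFun := innerDeriv (a : A) b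
                   map_add' := fun c d => by
                     simp only [innerDeriv, brac, mul_add, add_mul, mul_sub, sub_mul]; module
                   map_smul' := fun r c => by
                     simp only [innerDeriv, brac, mul_smul_comm, smul_mul_assoc, RingHom.id_apply]
                     module }, fun c d => inner_mul (a : A) b c d⟩)
    (fun a a' b => Subtype.ext (LinearMap.ext fun c => by
      change innerDeriv ((a : A) + a') (b : A) c = innerDeriv (a : A) b c + innerDeriv (a' : A) b c
      simp only [innerDeriv, brac, mul_add, add_mul, mul_sub, sub_mul]; module))
    (fun r a b => Subtype.ext (LinearMap.ext fun c => by
      change innerDeriv (r • (a : A)) (b : A) c = r • innerDeriv (a : A) b c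
      simp only [innerDeriv, brac, mul_smul_comm, smul_mul_assoc, ← smul_sub]; module))
    (fun a b b' => Subtype.ext (LinearMap.ext fun c => by
      change innerDeriv (a : A) ((b : A) + b') c = innerDeriv (a : A) b c + innerDeriv (a : A) b' c
      simp only [innerDeriv, brac, mul_add, add_mul, mul_sub, sub_mul]; module))
    (fun r a b => Subtype.ext (LinearMap.ext fun c => by
      change innerDeriv (a : A) (r • (b : A)) c = r • innerDeriv (a : A) b c
      simp only [innerDeriv, brac, mul_smul_comm, smul_mul_assoc, ← smul_sub]; module))

theorem innerDerA_apply (a b : Im A) (c : A) : (innerDerA a b).1 c = innerDeriv (a : A) b c := rfl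

/-- The commutator on the imaginary part. -/
def commIm : Im A →ₗ[ℝ] Im A →ₗ[ℝ] Im A :=
  LinearMap.mk₂ ℝ
    (fun a b => ⟨brac (a : A) b, by
      change star _ = - _
      rw [brac, star_sub, star_mul, star_mul, Im.star_eq_neg, Im.star_eq_neg]
      simp⟩)
    (fun a a' b => Subtype.ext (by
      change brac ((a : A) + a') (b : A) = brac (a : A) b + brac (a' : A) b
      simp only [brac, mul_add, add_mul]; module))
    (fun r a b => Subtype.ext (by
      change brac (r • (a : A)) (b : A) = r • brac (a : A) b
      simp only [brac, mul_smul_comm, smul_mul_assoc]; module))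
    (fun a b b' => Subtype.ext (by
      change brac (a : A) ((b : A) + b') = brac (a : A) b + brac (a : A) b'
      simp only [brac, mul_add, add_mul]; module))
    (fun r a b => Subtype.ext (by
      change brac (a : A) (r • (b : A)) = r • brac (a : A) b
      simp only [brac, mul_smul_comm, smul_mul_assoc]; module))

theorem coe_commIm (a b : Im A) : (commIm a b : A) = brac (a : A) b := rfl

/-- The bilinear form `Re (ab)` on the imaginary part. -/
noncomputable def reForm : Im A →ₗ[ℝ] Im A →ₗ[ℝ] ℝ :=
  ((LinearMap.mul ℝ A).compr₂ re).compl₁₂ (Im A).subtype (Im A).subtype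

theorem reForm_apply (a b : Im A) : reForm a b = re ((a : A) * b) := rfl

/-- The normalized trace form `tr (xy) / 3` on traceless Hermitian matrices. -/
noncomputable def traceForm : J30 A →ₗ[ℝ] J30 A →ₗ[ℝ] ℝ :=
  (1 / 3 : ℝ) • (J3.jordan.compr₂ J3.trace).compl₁₂ (J30 A).subtype (J30 A).subtype

theorem traceForm_apply (x y : J30 A) :
    traceForm x y = (1 / 3) * J3.trace (J3.jordan (x : J3 A) y) := rfl

/-- The traceless part of the Jordan product. -/
noncomputable def starProd : J30 A →ₗ[ℝ] J30 A →ₗ[ℝ] J30 A :=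
  LinearMap.mk₂ ℝ
    (fun x y => ⟨J3.jordan (x : J3 A) y - traceForm x y • J3.one, by
      rw [LinearMap.mem_ker, map_sub, map_smul, J3.trace_one, traceForm_apply, smul_eq_mul]
      ring⟩)
    (fun x x' y => Subtype.ext (by
      simp only [map_add, LinearMap.add_apply, Submodule.coe_add]; module))
    (fun r x y => Subtype.ext (by
      simp only [map_smul, LinearMap.smul_apply, Submodule.coe_smul, smul_eq_mul]; module))
    (fun x y y' => Subtype.ext (by
      simp only [map_add, Submodule.coe_add]; module))
    (fun r x y => Subtype.ext (by
      simp only [map_smul, Submodule.coe_smul, smul_eq_mul]; module))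

theorem coe_starProd (x y : J30 A) :
    (starProd x y : J3 A) = J3.jordan (x : J3 A) y - traceForm x y • J3.one := rfl

theorem derJ_coe_add (d e : DerJ A) : (d + e).1 = d.1 + e.1 := rfl

theorem derJ_coe_smul (r : ℝ) (d : DerJ A) : (r • d).1 = r • d.1 := rfl

/-- The derivation `[L_x, L_y]` of `J3 A`. -/
noncomputable def innerDerJ : J30 A →ₗ[ℝ] J30 A →ₗ[ℝ] DerJ A :=
  LinearMap.mk₂ ℝ
    (fun x y => ⟨J3.jordan x.1 ∘ₗ J3.jordan y.1 - J3.jordan y.1 ∘ₗ J3.jordan x.1,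
      fun z w => J3.isCubic.inner_deriv x.1 y.1 z w⟩)
    (fun x x' y => Subtype.ext (by
      rw [derJ_coe_add]
      simp only [Submodule.coe_add, map_add, LinearMap.add_comp, LinearMap.comp_add]; abel))
    (fun r x y => Subtype.ext (by
      rw [derJ_coe_smul]
      simp only [Submodule.coe_smul, map_smul, LinearMap.smul_comp, LinearMap.comp_smul, smul_sub]))
    (fun x y y' => Subtype.ext (by
      rw [derJ_coe_add]
      simp only [Submodule.coe_add, map_add, LinearMap.add_comp, LinearMap.comp_add]; abel))
    (fun r x y => Subtype.ext (by
      rw [derJ_coe_smul]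
      simp only [Submodule.coe_smul, map_smul, LinearMap.smul_comp, LinearMap.comp_smul, smul_sub]))

theorem innerDerJ_apply (x y : J30 A) (z : J3 A) : (innerDerJ x y).1 z =
    J3.jordan (x : J3 A) (J3.jordan y z) - J3.jordan (y : J3 A) (J3.jordan x z) := rfl

/-- The action of derivations on the imaginary part. -/
def derAIm : DerA A →ₗ[ℝ] Module.End ℝ (Im A) where
  toFun D := D.1.restrict fun a _ => derA_im D a
  map_add' _ _ := rfl
  map_smul' _ _ := rfl

theorem coe_derAIm (D : DerA A) (a : Im A) : (derAIm D a : A) = D.1 a := rfl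

theorem derJ_mem (d : DerJ A) (x : J3 A) : d.1 x ∈ J30 A := trace_derJ d x

/-- The action of derivations on traceless Hermitian matrices. -/
noncomputable def derJ0 : DerJ A →ₗ[ℝ] Module.End ℝ (J30 A) where
  toFun d := d.1.restrict fun x _ => derJ_mem d x
  map_add' _ _ := rfl
  map_smul' _ _ := rfl

theorem coe_derJ0 (d : DerJ A) (x : J30 A) : (derJ0 d x : J3 A) = d.1 x := rfl

theorem derAIm_lie (D E : DerA A) : derAIm ⁅D, E⁆ = derAIm D * derAIm E - derAIm E * derAIm D := rfl

theorem derJ0_lie (D E : DerJ A) : derJ0 ⁅D, E⁆ = derJ0 D * derJ0 E - derJ0 E * derJ0 D := rfl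

-- equivariance

theorem innerDerA_equivariant (D : DerA A) (a b : Im A) :
    ⁅D, innerDerA a b⁆ = innerDerA (derAIm D a) b + innerDerA a (derAIm D b) := by
  apply Subtype.ext
  apply LinearMap.ext
  intro c
  change D.1 (innerDeriv (a : A) b c) - innerDeriv (a : A) b (D.1 c)
    = innerDeriv (D.1 (a : A)) b c + innerDeriv (a : A) (D.1 b) c
  simp only [innerDeriv, brac, map_sub, map_smul, derA_mul, mul_sub, sub_mul, mul_add, add_mul]
  module

theorem commIm_equivariant (D : DerA A) (a b : Im A) :
    derAIm D (commIm a b) = commIm (derAIm D a) b + commIm a (derAIm D b) := by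
  apply Subtype.ext
  change D.1 (brac (a : A) b) = brac (D.1 (a : A)) b + brac (a : A) (D.1 b)
  simp only [brac, map_sub, derA_mul]
  abel

theorem reForm_invariant (D : DerA A) (a b : Im A) :
    reForm (derAIm D a) b + reForm a (derAIm D b) = 0 := by
  rw [reForm_apply, reForm_apply, ← map_add, coe_derAIm, coe_derAIm, ← derA_mul, re_derA]

theorem innerDerJ_equivariant (d : DerJ A) (x y : J30 A) :
    ⁅d, innerDerJ x y⁆ = innerDerJ (derJ0 d x) y + innerDerJ x (derJ0 d y) := by
  apply Subtype.ext
  apply LinearMap.ext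
  intro z
  change d.1 (J3.jordan (x : J3 A) (J3.jordan y z) - J3.jordan (y : J3 A) (J3.jordan x z))
    - (J3.jordan (x : J3 A) (J3.jordan y (d.1 z)) - J3.jordan (y : J3 A) (J3.jordan x (d.1 z)))
    = (J3.jordan (d.1 x) (J3.jordan y z) - J3.jordan (y : J3 A) (J3.jordan (d.1 x) z))
      + (J3.jordan (x : J3 A) (J3.jordan (d.1 y) z) - J3.jordan (d.1 y) (J3.jordan x z))
  simp only [map_sub, derJ_jordan, map_add]
  abel

theorem traceForm_invariant (d : DerJ A) (x y : J30 A) :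
    traceForm (derJ0 d x) y + traceForm x (derJ0 d y) = 0 := by
  rw [traceForm_apply, traceForm_apply, ← mul_add, ← map_add, coe_derJ0, coe_derJ0, ← derJ_jordan,
    trace_derJ, mul_zero]

theorem derJ_one (d : DerJ A) : d.1 J3.one = 0 := by
  have := derJ_jordan d J3.one J3.one
  rw [J3.one_jordan, J3.one_jordan, J3.jordan_comm, J3.one_jordan] at this
  simpa using this

theorem starProd_equivariant (d : DerJ A) (x y : J30 A) :
    derJ0 d (starProd x y) = starProd (derJ0 d x) y + starProd x (derJ0 d y) := by
  apply Subtype.ext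
  have h := traceForm_invariant d x y
  rw [Submodule.coe_add, coe_derJ0, coe_starProd, coe_starProd, coe_starProd, coe_derJ0, coe_derJ0,
    map_sub, map_smul, derJ_one, derJ_jordan]
  linear_combination (norm := module) h • (J3.one : J3 A)

-- symmetry

theorem innerDerA_swap (a b : Im A) : innerDerA b a = -innerDerA a b := by
  apply Subtype.ext
  apply LinearMap.ext
  intro c
  change innerDeriv (b : A) a c = -innerDeriv (a : A) b c
  have h := assoc_left (a : A) b c
  simp only [innerDeriv, brac]
  linear_combination (norm := skip) (-3 : ℝ) • h
  simp only [mul_sub, sub_mul]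
  module

theorem commIm_swap (a b : Im A) : commIm b a = -commIm a b :=
  Subtype.ext (neg_sub _ _).symm

theorem reForm_swap (a b : Im A) : reForm b a = reForm a b := re_mul_comm _ _

theorem traceForm_swap (x y : J30 A) : traceForm y x = traceForm x y := by
  rw [traceForm_apply, traceForm_apply, J3.jordan_comm]

theorem starProd_swap (x y : J30 A) : starProd y x = starProd x y := by
  apply Subtype.ext
  rw [coe_starProd, coe_starProd, J3.jordan_comm, traceForm_swap]

theorem innerDerJ_swap (x y : J30 A) : innerDerJ y x = -innerDerJ x y :=
  Subtype.ext (lie_skew _ _).symm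

-- cyclic identities

theorem innerDerA_cyclic (a b c : Im A) :
    innerDerA (commIm a b) c + innerDerA (commIm b c) a + innerDerA (commIm c a) b = 0 :=
  Subtype.ext (LinearMap.ext fun d => inner_comm_cyclic (a : A) b c d)

theorem reForm_comm (a b c : Im A) : reForm (commIm b c) a = reForm (commIm a b) c := by
  rw [reForm_apply, reForm_apply, coe_commIm, coe_commIm, brac, brac, sub_mul, sub_mul, map_sub,
    map_sub, re_mul_comm _ (a : A), re_mul_comm _ (a : A), re_mul_assoc (b : A), re_mul_comm (b : A),
    re_mul_assoc (a : A) c b, ← re_mul_assoc (a : A) b c]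

theorem traceForm_star (x y z : J30 A) :
    traceForm (starProd y z) x = traceForm (starProd x y) z := by
  have hx : J3.trace (x : J3 A) = 0 := x.2
  have hz : J3.trace (z : J3 A) = 0 := z.2
  rw [traceForm_apply, traceForm_apply, coe_starProd, coe_starProd, map_sub, map_sub, map_smul,
    map_smul, LinearMap.sub_apply, LinearMap.sub_apply, LinearMap.smul_apply, LinearMap.smul_apply,
    J3.one_jordan, J3.one_jordan, map_sub, map_sub, map_smul, map_smul, hx, hz, J3.trace_assoc x.1,
    J3.jordan_comm, smul_zero, smul_zero]

theorem innerDerJ_cyclic (x y z : J30 A) :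
    innerDerJ (starProd x y) z + innerDerJ (starProd y z) x + innerDerJ (starProd z x) y = 0 := by
  apply Subtype.ext
  apply LinearMap.ext
  intro w
  have h := J3.isCubic.cyclic (x : J3 A) y z w
  have c1 := J3.jordan_comm (z : J3 A) x
  simp only [derJ_coe_add, LinearMap.add_apply, innerDerJ_apply, coe_starProd, map_sub,
    LinearMap.sub_apply, map_smul, LinearMap.smul_apply, J3.one_jordan]
  change _ = (0 : J3 A)
  linear_combination (norm := module) h

end maps

/-- The underlying space `Der A × Der J3(B) ⊕ (Im A ⊗ J3(B)₀)` of the Tits construction. -/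
@[ext]
structure Tits (A B : Type) [NonAssocRing A] [StarRing A] [Module ℝ A] [RealNormedAlgebra A]
    [NonAssocRing B] [StarRing B] [Module ℝ B] [RealNormedAlgebra B] where
  der : DerA A × DerJ B
  tens : Im A ⊗[ℝ] J30 B

namespace Tits
open RealNormedAlgebra
variable {A B : Type} [NonAssocRing A] [StarRing A] [Module ℝ A] [RealNormedAlgebra A]
  [NonAssocRing B] [StarRing B] [Module ℝ B] [RealNormedAlgebra B]

/-- The underlying product. -/
def equivProd : Tits A B ≃ (DerA A × DerJ B) × (Im A ⊗[ℝ] J30 B) where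
  toFun x := (x.der, x.tens)
  invFun p := ⟨p.1, p.2⟩
  left_inv _ := rfl
  right_inv _ := rfl

noncomputable instance : AddCommGroup (Tits A B) := equivProd.addCommGroup
noncomputable instance : Module ℝ (Tits A B) := equivProd.module ℝ

@[simp] theorem der_zero : (0 : Tits A B).der = 0 := rfl
@[simp] theorem tens_zero : (0 : Tits A B).tens = 0 := rfl
@[simp] theorem der_add (x y : Tits A B) : (x + y).der = x.der + y.der := rfl
@[simp] theorem tens_add (x y : Tits A B) : (x + y).tens = x.tens + y.tens := rfl
@[simp] theorem der_smul (r : ℝ) (x : Tits A B) : (r • x).der = r • x.der := rfl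
@[simp] theorem tens_smul (r : ℝ) (x : Tits A B) : (r • x).tens = r • x.tens := rfl

/-- The real-linear identification with the underlying product. -/
noncomputable def linearEquivProd : Tits A B ≃ₗ[ℝ] (DerA A × DerJ B) × (Im A ⊗[ℝ] J30 B) :=
  equivProd.linearEquiv ℝ

/-- The action of `Der A × Der J3(B)` on `Im A ⊗ J3(B)₀`. -/
noncomputable def act : DerA A × DerJ B →ₗ[ℝ] Module.End ℝ (Im A ⊗[ℝ] J30 B) :=
  LinearMap.coprod (LinearMap.rTensorHom (J30 B) ∘ₗ derAIm) (LinearMap.lTensorHom (Im A) ∘ₗ derJ0)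

theorem act_tmul (D : DerA A × DerJ B) (a : Im A) (x : J30 B) :
    act D (a ⊗ₜ x) = derAIm D.1 a ⊗ₜ x + a ⊗ₜ derJ0 D.2 x := rfl

/-- The component in `Der A × Der J3(B)` of the bracket of two tensors:
`[a ⊗ x, b ⊗ y]` has components `(tr (xy) / 3) D_{a,b}` and `4 Re (ab) [L_x, L_y]`. -/
noncomputable def bracketDer :
    Im A ⊗[ℝ] J30 B →ₗ[ℝ] Im A ⊗[ℝ] J30 B →ₗ[ℝ] DerA A × DerJ B :=
  ((TensorProduct.map₂ innerDerA traceForm).compr₂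
      (LinearMap.inl ℝ (DerA A) (DerJ B) ∘ₗ (TensorProduct.rid ℝ (DerA A)).toLinearMap)) +
    (4 : ℝ) • ((TensorProduct.map₂ reForm innerDerJ).compr₂
      (LinearMap.inr ℝ (DerA A) (DerJ B) ∘ₗ (TensorProduct.lid ℝ (DerJ B)).toLinearMap))

theorem bracketDer_tmul (a b : Im A) (x y : J30 B) :
    bracketDer (a ⊗ₜ x) (b ⊗ₜ y) =
      (traceForm x y • innerDerA a b, (4 * reForm a b) • innerDerJ x y) := by
  simp [bracketDer, smul_smul]

/-- The component in `Im A ⊗ J3(B)₀` of the bracket of two tensors: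
`[a ⊗ x, b ⊗ y]` has component `[a, b] ⊗ (xy - tr (xy) / 3)`. -/
noncomputable def bracketTens :
    Im A ⊗[ℝ] J30 B →ₗ[ℝ] Im A ⊗[ℝ] J30 B →ₗ[ℝ] Im A ⊗[ℝ] J30 B :=
  TensorProduct.map₂ commIm starProd

theorem bracketTens_tmul (a b : Im A) (x y : J30 B) :
    bracketTens (a ⊗ₜ x) (b ⊗ₜ y) = commIm a b ⊗ₜ starProd x y := rfl

noncomputable instance : Bracket (Tits A B) (Tits A B) where
  bracket x y := ⟨⁅x.der, y.der⁆ + bracketDer x.tens y.tens,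
    bracketTens x.tens y.tens + act x.der y.tens - act y.der x.tens⟩

theorem der_lie (x y : Tits A B) : ⁅x, y⁆.der = ⁅x.der, y.der⁆ + bracketDer x.tens y.tens := rfl

theorem tens_lie (x y : Tits A B) :
    ⁅x, y⁆.tens = bracketTens x.tens y.tens + act x.der y.tens - act y.der x.tens := rfl

theorem act_lie (D E : DerA A × DerJ B) (u : Im A ⊗[ℝ] J30 B) :
    act ⁅D, E⁆ u = act D (act E u) - act E (act D u) := by
  induction u using TensorProduct.induction_on with
  | zero => simp
  | add u v hu hv => simp only [map_add, hu, hv]; abel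
  | tmul a x =>
    have h1 : derAIm ⁅D, E⁆.1 a = derAIm D.1 (derAIm E.1 a) - derAIm E.1 (derAIm D.1 a) := rfl
    have h2 : derJ0 ⁅D, E⁆.2 x = derJ0 D.2 (derJ0 E.2 x) - derJ0 E.2 (derJ0 D.2 x) := rfl
    simp only [act_tmul, map_add, h1, h2, TensorProduct.sub_tmul, TensorProduct.tmul_sub]
    abel

theorem bracketDer_swap (u v : Im A ⊗[ℝ] J30 B) : bracketDer v u = -bracketDer u v := by
  induction u using TensorProduct.induction_on with
  | zero => simp
  | add u u' hu hu' => simp only [map_add, hu, hu', LinearMap.add_apply]; abel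
  | tmul a x =>
    induction v using TensorProduct.induction_on with
    | zero => simp
    | add v v' hv hv' => simp only [map_add, hv, hv', LinearMap.add_apply]; abel
    | tmul b y =>
      rw [bracketDer_tmul, bracketDer_tmul, innerDerA_swap, innerDerJ_swap, traceForm_swap,
        reForm_swap, smul_neg, smul_neg, Prod.neg_mk]

theorem bracketTens_swap (u v : Im A ⊗[ℝ] J30 B) : bracketTens v u = -bracketTens u v := by
  induction u using TensorProduct.induction_on with
  | zero => simp
  | add u u' hu hu' => simp only [map_add, hu, hu', LinearMap.add_apply]; abel
  | tmul a x =>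
    induction v using TensorProduct.induction_on with
    | zero => simp
    | add v v' hv hv' => simp only [map_add, hv, hv', LinearMap.add_apply]; abel
    | tmul b y =>
      rw [bracketTens_tmul, bracketTens_tmul, commIm_swap, starProd_swap, TensorProduct.neg_tmul]

theorem bracketDer_equivariant (D : DerA A × DerJ B) (u v : Im A ⊗[ℝ] J30 B) :
    ⁅D, bracketDer u v⁆ = bracketDer (act D u) v + bracketDer u (act D v) := by
  induction u using TensorProduct.induction_on with
  | zero => simp
  | add u u' hu hu' => simp only [map_add, lie_add, hu, hu', LinearMap.add_apply]; abel
  | tmul a x =>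
    induction v using TensorProduct.induction_on with
    | zero => simp
    | add v v' hv hv' => simp only [map_add, lie_add, hv, hv']; abel
    | tmul b y =>
      have h1 := innerDerA_equivariant D.1 a b
      have h2 := innerDerJ_equivariant D.2 x y
      have h3 := reForm_invariant D.1 a b
      have h4 := traceForm_invariant D.2 x y
      simp only [act_tmul, map_add, LinearMap.add_apply, bracketDer_tmul]
      apply Prod.ext
      · change ⁅D.1, traceForm x y • innerDerA a b⁆ = _
        rw [lie_smul, h1]
        simp only [Prod.fst_add]
        linear_combination (norm := module) (-h4) • innerDerA a b
      · change ⁅D.2, (4 * reForm a b) • innerDerJ x y⁆ = _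
        rw [lie_smul, h2]
        simp only [Prod.snd_add]
        linear_combination (norm := module) (-(4 : ℝ) * h3) • innerDerJ x y

theorem bracketTens_equivariant (D : DerA A × DerJ B) (u v : Im A ⊗[ℝ] J30 B) :
    act D (bracketTens u v) = bracketTens (act D u) v + bracketTens u (act D v) := by
  induction u using TensorProduct.induction_on with
  | zero => simp
  | add u u' hu hu' => simp only [map_add, hu, hu', LinearMap.add_apply]; abel
  | tmul a x =>
    induction v using TensorProduct.induction_on with
    | zero => simp
    | add v v' hv hv' => simp only [map_add, hv, hv']; abel
    | tmul b y =>
      simp only [act_tmul, map_add, LinearMap.add_apply, bracketTens_tmul, commIm_equivariant,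
        starProd_equivariant, TensorProduct.add_tmul, TensorProduct.tmul_add]
      abel

theorem bracketDer_cyclic (u v w : Im A ⊗[ℝ] J30 B) :
    bracketDer (bracketTens u v) w + bracketDer (bracketTens v w) u
      + bracketDer (bracketTens w u) v = 0 := by
  induction u using TensorProduct.induction_on with
  | zero => simp
  | add u u' hu hu' =>
    simp only [map_add, LinearMap.add_apply]
    linear_combination (norm := module) hu + hu'
  | tmul a x =>
    induction v using TensorProduct.induction_on with
    | zero => simp
    | add v v' hv hv' =>
      simp only [map_add, LinearMap.add_apply]
      linear_combination (norm := module) hv + hv'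
    | tmul b y =>
      induction w using TensorProduct.induction_on with
      | zero => simp
      | add w w' hw hw' =>
        simp only [map_add, LinearMap.add_apply]
        linear_combination (norm := module) hw + hw'
      | tmul c z =>
        have h1 := innerDerA_cyclic a b c
        have h2 := innerDerJ_cyclic x y z
        have t1 := traceForm_star x y z
        have t2 := traceForm_star y z x
        have r1 := reForm_comm a b c
        have r2 := reForm_comm b c a
        simp only [bracketTens_tmul, bracketDer_tmul]
        rw [t2, t1, r2, r1]
        apply Prod.ext
        · simp only [Prod.fst_add, Prod.fst_zero]
          linear_combination (norm := module) traceForm (starProd x y) z • h1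
        · simp only [Prod.snd_add, Prod.snd_zero]
          linear_combination (norm := module) (4 * reForm (commIm a b) c) • h2

theorem im_identities (a b c : Im A) : ∃ s : Im A,
    (commIm (commIm a b) c = (4 * reForm b c) • a - (4 * reForm c a) • b + (2 : ℝ) • s) ∧
    (derAIm (innerDerA a b) c =
      (4 * reForm b c) • a - (4 * reForm c a) • b + (-1 : ℝ) • s) ∧
    (commIm (commIm b c) a = (4 * reForm c a) • b - (4 * reForm a b) • c + (2 : ℝ) • s) ∧
    (derAIm (innerDerA b c) a =
      (4 * reForm c a) • b - (4 * reForm a b) • c + (-1 : ℝ) • s) ∧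
    (commIm (commIm c a) b = (4 * reForm a b) • c - (4 * reForm b c) • a + (2 : ℝ) • s) ∧
    (derAIm (innerDerA c a) b =
      (4 * reForm a b) • c - (4 * reForm b c) • a + (-1 : ℝ) • s) := by
  have k : ∀ a b c : Im A, brac (brac (a : A) b) c = (4 * re ((b : A) * c)) • (a : A)
      - (4 * re ((c : A) * a)) • (b : A) + (2 : ℝ) • ((a : A) * b * c - a * (b * c)) := fun a b c =>
    brac_brac_im (a : A) b c a.2 b.2 c.2
  have h1 : (b : A) * c * a - b * (c * a) = a * b * c - a * (b * c) := by
    linear_combination (norm := module) assoc_right (b : A) c a - assoc_left (a : A) b c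
  have h2 : (c : A) * a * b - c * (a * b) = a * b * c - a * (b * c) := by
    linear_combination (norm := module) assoc_left (c : A) a b - assoc_right (a : A) b c
  have hs : (a : A) * b * c - a * (b * c) ∈ Im A := by
    change star _ = - _
    rw [star_sub, star_mul, star_mul, star_mul, star_mul, Im.star_eq_neg, Im.star_eq_neg,
      Im.star_eq_neg]
    simp only [mul_neg, neg_mul, neg_neg]
    linear_combination (norm := module) assoc_left (c : A) b a - assoc_right (b : A) c a
      + assoc_left (b : A) a c
  have k1 := k a b c
  have k2 := k b c a
  have k3 := k c a b
  rw [h1] at k2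
  rw [h2] at k3
  refine ⟨⟨(a : A) * b * c - a * (b * c), hs⟩, Subtype.ext k1, Subtype.ext ?_, Subtype.ext k2,
    Subtype.ext ?_, Subtype.ext k3, Subtype.ext ?_⟩
  · change brac (brac (a : A) b) c - (3 : ℝ) • ((a : A) * b * c - a * (b * c)) =
      (4 * re ((b : A) * c)) • (a : A) - (4 * re ((c : A) * a)) • (b : A)
        + (-1 : ℝ) • ((a : A) * b * c - a * (b * c))
    rw [k1]; module
  · change brac (brac (b : A) c) a - (3 : ℝ) • ((b : A) * c * a - b * (c * a)) =
      (4 * re ((c : A) * a)) • (b : A) - (4 * re ((a : A) * b)) • (c : A)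
        + (-1 : ℝ) • ((a : A) * b * c - a * (b * c))
    rw [k2, h1]; module
  · change brac (brac (c : A) a) b - (3 : ℝ) • ((c : A) * a * b - c * (a * b)) =
      (4 * re ((a : A) * b)) • (c : A) - (4 * re ((b : A) * c)) • (a : A)
        + (-1 : ℝ) • ((a : A) * b * c - a * (b * c))
    rw [k3, h2]; module

theorem star_identity (x y z : J30 B) :
    starProd (starProd z x) y = (1 / 2 : ℝ) • (traceForm x y • z + traceForm y z • x
      + traceForm z x • y) - starProd (starProd x y) z - starProd (starProd y z) x := by
  apply Subtype.ext
  have h := J3.isCubic.polar_zero (x : J3 B) y z x.2 y.2 z.2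
  have t1 := traceForm_star x y z
  have t2 := traceForm_star y z x
  have t3 : traceForm (starProd x y) z = (1 / 3) * J3.trace (J3.jordan (J3.jordan x.1 y) z) := by
    have hz : J3.trace (z : J3 B) = 0 := z.2
    rw [traceForm_apply, coe_starProd, map_sub, map_smul, LinearMap.sub_apply,
      LinearMap.smul_apply, J3.one_jordan, map_sub, map_smul, hz, smul_zero, sub_zero]
  change J3.jordan (J3.jordan z.1 x - traceForm z x • J3.one) y.1
      - traceForm (starProd z x) y • J3.one =
    (1 / 2 : ℝ) • (traceForm x y • z.1 + traceForm y z • x.1 + traceForm z x • y.1)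
      - (J3.jordan (J3.jordan x.1 y - traceForm x y • J3.one) z.1
          - traceForm (starProd x y) z • J3.one)
      - (J3.jordan (J3.jordan y.1 z - traceForm y z • J3.one) x.1
          - traceForm (starProd y z) x • J3.one)
  rw [t2, t1, t3]
  simp only [map_sub, map_smul, LinearMap.sub_apply, LinearMap.smul_apply, J3.one_jordan,
    traceForm_apply]
  linear_combination (norm := module) (1 / 2 : ℝ) • h

theorem derJ0_innerDerJ (x y z : J30 B) : derJ0 (innerDerJ x y) z =
    (starProd (starProd y z) x + traceForm y z • x)
      - (starProd (starProd z x) y + traceForm z x • y) := by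
  apply Subtype.ext
  have t2 := traceForm_star y z x
  have c1 := J3.jordan_comm x.1 (J3.jordan y.1 z)
  have c2 := J3.jordan_comm y.1 (J3.jordan x.1 z)
  have c3 := J3.jordan_comm x.1 z
  change J3.jordan x.1 (J3.jordan y.1 z) - J3.jordan y.1 (J3.jordan x.1 z) =
    (J3.jordan (J3.jordan y.1 z - traceForm y z • J3.one) x.1
          - traceForm (starProd y z) x • J3.one + traceForm y z • x.1)
      - (J3.jordan (J3.jordan z.1 x - traceForm z x • J3.one) y.1
          - traceForm (starProd z x) y • J3.one + traceForm z x • y.1)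
  rw [t2, c1, c2, c3]
  simp only [map_sub, map_smul, LinearMap.sub_apply, LinearMap.smul_apply, J3.one_jordan]
  module

theorem tens_cyclic (u v w : Im A ⊗[ℝ] J30 B) :
    (bracketTens (bracketTens u v) w + act (bracketDer u v) w)
      + (bracketTens (bracketTens v w) u + act (bracketDer v w) u)
      + (bracketTens (bracketTens w u) v + act (bracketDer w u) v) = 0 := by
  induction u using TensorProduct.induction_on with
  | zero => simp
  | add u u' hu hu' =>
    simp only [map_add, LinearMap.add_apply]
    linear_combination (norm := module) hu + hu'
  | tmul a x =>
    induction v using TensorProduct.induction_on with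
    | zero => simp
    | add v v' hv hv' =>
      simp only [map_add, LinearMap.add_apply]
      linear_combination (norm := module) hv + hv'
    | tmul b y =>
      induction w using TensorProduct.induction_on with
      | zero => simp
      | add w w' hw hw' =>
        simp only [map_add, LinearMap.add_apply]
        linear_combination (norm := module) hw + hw'
      | tmul c z =>
        obtain ⟨s, h1, h2, h3, h4, h5, h6⟩ := im_identities a b c
        have k := star_identity x y z
        simp only [bracketTens_tmul, bracketDer_tmul, act_tmul, map_smul, LinearMap.smul_apply,
          h1, h2, h3, h4, h5, h6, derJ0_innerDerJ, k]
        simp only [TensorProduct.add_tmul, TensorProduct.sub_tmul, TensorProduct.tmul_add,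
          TensorProduct.tmul_sub, ← TensorProduct.smul_tmul', TensorProduct.tmul_smul,
          smul_add, smul_sub]
        module

theorem eq_zero_of_eq_neg {M : Type} [AddCommGroup M] [Module ℝ M] {v : M} (h : v = -v) :
    v = 0 := by
  linear_combination (norm := module) (1 / 2 : ℝ) • h

section leibniz
variable {L M : Type} [LieRing L] [LieAlgebra ℝ L] [AddCommGroup M] [Module ℝ M]
  (ρ : L →ₗ[ℝ] Module.End ℝ M) (β : M →ₗ[ℝ] M →ₗ[ℝ] L) (γ : M →ₗ[ℝ] M →ₗ[ℝ] M)

theorem leibniz_der (hβ : ∀ u v, β v u = -β u v) (hγ : ∀ u v, γ v u = -γ u v)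
    (he : ∀ x u v, ⁅x, β u v⁆ = β (ρ x u) v + β u (ρ x v))
    (hc : ∀ u v w, β (γ u v) w + β (γ v w) u + β (γ w u) v = 0) (x y z : L) (u v w : M) :
    ⁅x, ⁅y, z⁆ + β v w⁆ + β u (γ v w + ρ y w - ρ z v) =
      ⁅⁅x, y⁆ + β u v, z⁆ + β (γ u v + ρ x v - ρ y u) w
        + (⁅y, ⁅x, z⁆ + β u w⁆ + β v (γ u w + ρ x w - ρ z u)) := by
  have l := leibniz_lie x y z
  have l2 := lie_skew (β u v) z
  have c := hc u v w
  have g := congrArg (fun m => β m v) (hγ u w)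
  simp only [map_neg, LinearMap.neg_apply] at g
  simp only [lie_add, add_lie, map_add, map_sub, LinearMap.add_apply, LinearMap.sub_apply, he,
    hβ (γ v w) u, hβ (γ u w) v, hβ (ρ z u) v] at l2 ⊢
  linear_combination (norm := module) l + l2 - c + g

theorem leibniz_tens (hγ : ∀ u v, γ v u = -γ u v) (hβ : ∀ u v, β v u = -β u v)
    (hρ : ∀ x y u, ρ ⁅x, y⁆ u = ρ x (ρ y u) - ρ y (ρ x u))
    (he : ∀ x u v, ρ x (γ u v) = γ (ρ x u) v + γ u (ρ x v))
    (hc : ∀ u v w, (γ (γ u v) w + ρ (β u v) w) + (γ (γ v w) u + ρ (β v w) u)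
      + (γ (γ w u) v + ρ (β w u) v) = 0) (x y z : L) (u v w : M) :
    γ u (γ v w + ρ y w - ρ z v) + ρ x (γ v w + ρ y w - ρ z v) - ρ (⁅y, z⁆ + β v w) u =
      (γ (γ u v + ρ x v - ρ y u) w + ρ (⁅x, y⁆ + β u v) w - ρ z (γ u v + ρ x v - ρ y u))
      + (γ v (γ u w + ρ x w - ρ z u) + ρ y (γ u w + ρ x w - ρ z u) - ρ (⁅x, z⁆ + β u w) v) := by
  have c := hc u v w
  have g := congrArg (fun m => γ m v) (hγ u w)
  have g2 := congrArg (fun m => ρ m v) (hβ u w)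
  simp only [map_neg, LinearMap.neg_apply] at g g2
  simp only [map_add, map_sub, LinearMap.add_apply, LinearMap.sub_apply, he, hρ,
    hγ (γ v w) u, hγ (γ u w) v, hγ (ρ z u) v]
  linear_combination (norm := module) g + g2 - c

end leibniz

noncomputable instance : LieRing (Tits A B) where
  add_lie x y z := by
    ext1
    · simp only [der_lie, der_add, tens_add, add_lie, map_add, LinearMap.add_apply]; abel
    · simp only [tens_lie, tens_add, der_add, map_add, LinearMap.add_apply]; abel
  lie_add x y z := by
    ext1
    · simp only [der_lie, der_add, tens_add, lie_add, map_add]; abel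
    · simp only [tens_lie, tens_add, der_add, map_add, LinearMap.add_apply]; abel
  lie_self x := by
    have h1 := bracketDer_swap x.tens x.tens
    have h2 := bracketTens_swap x.tens x.tens
    ext1
    · rw [der_lie, lie_self, der_zero, zero_add]
      exact eq_zero_of_eq_neg h1
    · rw [tens_lie, tens_zero, add_sub_cancel_right]
      exact eq_zero_of_eq_neg h2
  leibniz_lie x y z := by
    ext1
    · exact leibniz_der act bracketDer bracketTens bracketDer_swap bracketTens_swap
        bracketDer_equivariant bracketDer_cyclic x.der y.der z.der x.tens y.tens z.tens
    · exact leibniz_tens act bracketDer bracketTens bracketTens_swap bracketDer_swap act_lie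
        bracketTens_equivariant tens_cyclic x.der y.der z.der x.tens y.tens z.tens

noncomputable instance : LieAlgebra ℝ (Tits A B) where
  lie_smul r x y := by
    ext1
    · simp only [der_lie, der_smul, tens_smul, lie_smul, map_smul, smul_add]
    · simp only [tens_lie, der_smul, tens_smul, map_smul, LinearMap.smul_apply, smul_add, smul_sub]

end Tits

section finiteness
open RealNormedAlgebra
variable {A B : Type} [NonAssocRing A] [StarRing A] [Module ℝ A] [RealNormedAlgebra A]
  [NonAssocRing B] [StarRing B] [Module ℝ B] [RealNormedAlgebra B]

instance derivationAlgebra.finite {V : Type} [AddCommGroup V] [Module ℝ V] [Module.Finite ℝ V]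
    (m : V →ₗ[ℝ] V →ₗ[ℝ] V) : Module.Finite ℝ (derivationAlgebra m) :=
  Module.Finite.of_injective (derivationAlgebra m).toSubmodule.subtype Subtype.val_injective

instance J3.finite : Module.Finite ℝ (J3 A) :=
  Module.Finite.of_injective J3.toMatrix fun x y h => J3.ext h

instance Tits.finite : Module.Finite ℝ (Tits A B) :=
  Module.Finite.equiv Tits.linearEquivProd.symm

end finiteness

/-- The embedding of `Der J3(B)` in the Lie algebra `Tits A B`. -/
noncomputable def Tits.ofDerJ (A B : Type) [NonAssocRing A] [StarRing A] [Module ℝ A]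
    [RealNormedAlgebra A] [NonAssocRing B] [StarRing B] [Module ℝ B] [RealNormedAlgebra B] :
    DerJ B →ₗ⁅ℝ⁆ Tits A B where
  toFun d := ⟨(0, d), 0⟩
  map_add' d e := by ext1 <;> simp
  map_smul' r d := by ext1 <;> simp
  map_lie' {d e} := by ext1 <;> simp [Tits.der_lie, Tits.tens_lie]

section orbits
variable (L : Type) [LieRing L] [LieAlgebra ℂ L] [Module.Finite ℂ L]

/-- Coordinates on a finite-dimensional complex vector space. -/
noncomputable def coords : L ≃ₗ[ℂ] (Fin (Module.finrank ℂ L) → ℂ) :=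
  (Module.finBasis ℂ L).equivFun

/-- The exponential of an endomorphism, as the exponential of its matrix in some basis
(the result does not depend on the basis). -/
noncomputable def endExp (f : Module.End ℂ L) : Module.End ℂ L :=
  Matrix.toLin (Module.finBasis ℂ L) (Module.finBasis ℂ L)
    (NormedSpace.exp (LinearMap.toMatrix (Module.finBasis ℂ L) (Module.finBasis ℂ L) f))

/-- The adjoint group of `L`: the group of automorphisms generated by all `exp (ad x)`. -/
noncomputable def adjointGroup : Subgroup (Module.End ℂ L)ˣ :=
  Subgroup.closure {g | ∃ x : L, (g : Module.End ℂ L) = endExp L (LieAlgebra.ad ℂ L x)}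

/-- The adjoint orbit of `X`. -/
def adjointOrbit (X : L) : Set L :=
  {Y | ∃ g ∈ adjointGroup L, (g : Module.End ℂ L) X = Y}

end orbits

/-- `S` is an immersed complex submanifold of complex dimension `d` of `E`: the image of a
holomorphic injective immersion of a Hausdorff, second countable complex manifold of dimension `d`.
Since second countability is part of the definition, `d` is determined by `S` if `S` is nonempty. -/
def IsImmersedSubmanifold {E : Type} [NormedAddCommGroup E] [NormedSpace ℂ E] (S : Set E)
    (d : ℕ) : Prop :=
  ∃ (M : Type) (_ : TopologicalSpace M) (_ : ChartedSpace (EuclideanSpace ℂ (Fin d)) M)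
    (_ : IsManifold 𝓘(ℂ, EuclideanSpace ℂ (Fin d)) ω M) (f : M → E),
    T2Space M ∧ SecondCountableTopology M ∧
    ContMDiff 𝓘(ℂ, EuclideanSpace ℂ (Fin d)) 𝓘(ℂ, E) ω f ∧
    (∀ p, Function.Injective (mfderiv 𝓘(ℂ, EuclideanSpace ℂ (Fin d)) 𝓘(ℂ, E) f p)) ∧
    Function.Injective f ∧ Set.range f = S

/-- The orbit of `X`, an element of `f4 = Der J3(𝕆) ⊗ ℂ` regarded as an element of
`g(A, 𝕆) = Tits A 𝕆 ⊗ ℂ`, under the adjoint group of `g(A, 𝕆)`, is an (immersed) complex manifold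
of complex dimension `d`. -/
def OrbitHasDim (A : Type) [NonAssocRing A] [StarRing A] [Module ℝ A] [RealNormedAlgebra A]
    (X : ℂ ⊗[ℝ] DerJ Octonion) (d : ℕ) : Prop :=
  IsImmersedSubmanifold
    (coords (ℂ ⊗[ℝ] Tits A Octonion) ''
      adjointOrbit (ℂ ⊗[ℝ] Tits A Octonion)
        ((Tits.ofDerJ A Octonion).toLinearMap.baseChange ℂ X)) d

/-! The dimension count is linear algebra. Under `f4 = Der J3(𝕆) ⊗ ℂ`, the algebra `g(A, 𝕆)` splits
into the trivial module `Der A ⊗ ℂ`, the adjoint module `f4`, and `dim Im A = a - 1` copies of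
`J3(𝕆)₀ ⊗ ℂ`: an element of `f4` commutes with `Der A` and acts on `Im A ⊗ J3(𝕆)₀` through the
second factor only. If `r` and `s` are the ranks of `X` on `f4` and on `J3(𝕆)₀ ⊗ ℂ`, then `ad X` has
rank `r + (a - 1) s` on `g(A, 𝕆)`, and neither `r` nor `s` depends on `A`. This is
`finrank_range_ad_ofDerJ`.

The geometric half is that an adjoint orbit is an immersed submanifold whose dimension is the rank
of `ad X`. It is proved for any space `h` of operators on a finite-dimensional space `E` that is
closed under commutators, and for the orbit of a point `p` under the exponentials of elements of `h`
(`isImmersedSubmanifold_expOrbit`). Conjugation by `exp A` preserves `h`, so the spaces `h x = {B x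
| B ∈ h}` have constant dimension `d` along the orbit. The maps `v ↦ exp (ι v) q`, reparametrized by
the inverse function theorem, give holomorphic local sections of linear projections onto `ℂ^d`,
tangent to the orbit (`exists_isLocalSection`).

The crucial step is a uniqueness statement, `IsLocalSection.eventually_eq`. A tangential map with
values in the orbit and its lift through a local section have the same projection, and along
segments both solve the same Lipschitz differential equation; so they agree near a point where they
meet. Hence chart overlaps are open, and the local sections define a manifold structure on the
orbit, whose topology may be finer than the subspace topology. The same statement makes the action
of the exponentials continuous for this topology. The orbit is then a countable union of compact
sets, which gives second countability, the condition that makes the dimension meaningful. -/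

/-! ### The exponential in a Banach algebra: conjugation and derivative. -/

section exponential
open NormedSpace
variable {𝔸 : Type*} [NormedRing 𝔸] [NormedAlgebra ℂ 𝔸] [CompleteSpace 𝔸]

theorem exp_mul_exp_neg_of_complex (A : 𝔸) : exp A * exp (-A) = 1 := by
  let _ : NormedAlgebra ℚ 𝔸 := .restrictScalars ℚ ℂ 𝔸
  rw [← exp_add_of_commute (Commute.neg_right (Commute.refl A)), add_neg_cancel, exp_zero]

theorem exp_neg_mul_exp_of_complex (A : 𝔸) : exp (-A) * exp A = 1 := by
  simpa using exp_mul_exp_neg_of_complex (-A)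

/-- Conjugation by `exp A` is the exponential of `ad A`. -/
theorem exp_conj_eq_exp_ad (A B : 𝔸) :
    exp A * B * exp (-A) =
      exp (ContinuousLinearMap.mul ℂ 𝔸 A - (ContinuousLinearMap.mul ℂ 𝔸).flip A) B := by
  let _ : NormedAlgebra ℚ (𝔸 →L[ℂ] 𝔸) := .restrictScalars ℚ ℂ (𝔸 →L[ℂ] 𝔸)
  -- Left and right multiplications commute by associativity, so the exponential of their difference
  -- is the product of their exponentials, which are multiplication by `exp A` on the left and by
  -- `exp (-A)` on the right.
  have hcomm : Commute (ContinuousLinearMap.mul ℂ 𝔸 A)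
      (-(ContinuousLinearMap.mul ℂ 𝔸).flip A) := by
    ext C
    simp [mul_assoc]
  have hpowl : ∀ n : ℕ, ∀ C, ((ContinuousLinearMap.mul ℂ 𝔸 A) ^ n) C = A ^ n * C := by
    intro n
    induction n with
    | zero => simp
    | succ n ih => intro C; rw [pow_succ, ContinuousLinearMap.mul_def, ContinuousLinearMap.comp_apply, ih]; simp [pow_succ, mul_assoc]
  have hpowr : ∀ n : ℕ, ∀ C, ((-(ContinuousLinearMap.mul ℂ 𝔸).flip A) ^ n) C = C * (-A) ^ n := by
    intro n
    induction n with
    | zero => simp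
    | succ n ih => intro C; rw [pow_succ, ContinuousLinearMap.mul_def, ContinuousLinearMap.comp_apply, ih]; simp [pow_succ', mul_assoc]
  have hl : ∀ C, exp (ContinuousLinearMap.mul ℂ 𝔸 A) C = exp A * C := by
    intro C
    have h1 := (exp_series_hasSum_exp' (𝕂 := ℂ) (ContinuousLinearMap.mul ℂ 𝔸 A)).mapL
      (ContinuousLinearMap.apply ℂ 𝔸 C)
    have h2 := (exp_series_hasSum_exp' (𝕂 := ℂ) A).mul_right C
    exact h1.unique (by simpa [hpowl] using h2)
  have hr : ∀ C, exp (-(ContinuousLinearMap.mul ℂ 𝔸).flip A) C = C * exp (-A) := by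
    intro C
    have h1 := (exp_series_hasSum_exp' (𝕂 := ℂ) (-(ContinuousLinearMap.mul ℂ 𝔸).flip A)).mapL
      (ContinuousLinearMap.apply ℂ 𝔸 C)
    have h2 := (exp_series_hasSum_exp' (𝕂 := ℂ) (-A)).mul_left C
    exact h1.unique (by simpa [hpowr] using h2)
  rw [sub_eq_add_neg, exp_add_of_commute hcomm, ContinuousLinearMap.mul_def, ContinuousLinearMap.comp_apply, hr, hl, mul_assoc]

/-- The conjugate is the sum of the series of terms `(ad A)^n B / n!`. Each term lies in `h` because
`h` is stable under commutators, and the sum does because `h` is closed. -/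
theorem exp_conj_mem {h : Submodule ℂ 𝔸} (hc : IsClosed (h : Set 𝔸))
    (hlie : ∀ A ∈ h, ∀ B ∈ h, A * B - B * A ∈ h) {A B : 𝔸} (hA : A ∈ h) (hB : B ∈ h) :
    exp A * B * exp (-A) ∈ h := by
  rw [exp_conj_eq_exp_ad]
  have h1 := (exp_series_hasSum_exp' (𝕂 := ℂ)
    (ContinuousLinearMap.mul ℂ 𝔸 A - (ContinuousLinearMap.mul ℂ 𝔸).flip A)).mapL
      (ContinuousLinearMap.apply ℂ 𝔸 B)
  have hpow : ∀ n : ℕ, ((ContinuousLinearMap.mul ℂ 𝔸 A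
      - (ContinuousLinearMap.mul ℂ 𝔸).flip A) ^ n) B ∈ h := by
    intro n
    induction n with
    | zero => simpa
    | succ n ih => rw [pow_succ', ContinuousLinearMap.mul_def, ContinuousLinearMap.comp_apply]; simpa using hlie A hA _ ih
  refine hc.mem_of_tendsto h1 (.of_forall fun s => ?_)
  exact h.sum_mem fun n _ => by simpa using h.smul_mem _ (hpow n)

/-- Duhamel's formula. The curve `s ↦ exp ((1 - s) A) exp (s (A + B))` joins `exp A` to `exp (A +
B)`; in its derivative the two terms containing `A` cancel and only `B` survives. -/
theorem exp_add_sub_exp_eq_integral (A B : 𝔸) :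
    exp (A + B) - exp A = ∫ s in (0 : ℝ)..1,
      exp ((1 - s) • A) * B * exp (s • (A + B)) := by
  let _ : NormedAlgebra ℚ 𝔸 := .restrictScalars ℚ ℂ 𝔸
  have hd : ∀ s : ℝ, HasDerivAt (fun s : ℝ => exp ((1 - s) • A) * exp (s • (A + B)))
      (exp ((1 - s) • A) * B * exp (s • (A + B))) s := by
    intro s
    have h1 := (hasDerivAt_exp_smul_const (𝕂 := ℝ) A (1 - s)).scomp s
      ((hasDerivAt_id s).const_sub 1)
    have h2 := hasDerivAt_exp_smul_const' (𝕂 := ℝ) (A + B) s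
    refine (h1.mul h2).congr_deriv ?_
    change (-1 : ℝ) • (exp ((1 - s) • A) * A) * exp (s • (A + B))
      + exp ((1 - s) • A) * ((A + B) * exp (s • (A + B))) = _
    rw [neg_one_smul]
    noncomm_ring
  rw [intervalIntegral.integral_eq_sub_of_hasDerivAt (fun s _ => hd s)]
  · simp
  · apply Continuous.intervalIntegrable
    have := exp_continuous (𝔸 := 𝔸)
    fun_prop

/-- The derivative of the exponential at `A` takes values in `h * exp A`. -/
theorem fderiv_exp_mem {h : Submodule ℂ 𝔸} (hc : IsClosed (h : Set 𝔸))
    (hlie : ∀ A ∈ h, ∀ B ∈ h, A * B - B * A ∈ h) {A B : 𝔸} (hA : A ∈ h) (hB : B ∈ h) :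
    fderiv ℂ exp A B * exp (-A) ∈ h := by
  let _ : NormedAlgebra ℚ 𝔸 := .restrictScalars ℚ ℂ 𝔸
  have hcont := exp_continuous (𝔸 := 𝔸)
  have hI : Continuous fun t : ℝ => ∫ s in (0 : ℝ)..1,
      exp ((1 - s) • A) * B * exp (s • (A + t • B)) :=
    intervalIntegral.continuous_parametric_intervalIntegral_of_continuous (s := fun _ => (1 : ℝ))
      (by fun_prop) continuous_const
  have h1 : HasDerivAt (fun t : ℝ => exp (A + t • B)) (fderiv ℂ exp A B) 0 := by
    have hd : HasFDerivAt (exp : 𝔸 → 𝔸) ((fderiv ℂ exp A).restrictScalars ℝ) (A + (0 : ℝ) • B) := by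
      rw [zero_smul, add_zero]
      exact (exp_analytic (𝕂 := ℂ) A).differentiableAt.hasFDerivAt.restrictScalars ℝ
    have hl : HasDerivAt (fun t : ℝ => A + t • B) B 0 := by
      simpa using ((hasDerivAt_id (0 : ℝ)).smul_const B).const_add A
    exact hd.comp_hasDerivAt (0 : ℝ) hl
  -- The difference quotient is Duhamel's formula for `t • B` divided by `t`. The resulting integral
  -- is continuous in `t`, including at `t = 0`, so the derivative is its value there.
  have h2 : HasDerivAt (fun t : ℝ => exp (A + t • B)) (∫ s in (0 : ℝ)..1,
      exp ((1 - s) • A) * B * exp (s • A)) 0 := by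
    rw [hasDerivAt_iff_tendsto_slope]
    have h3 := hI.tendsto 0
    simp only [zero_smul, add_zero] at h3
    refine (h3.mono_left nhdsWithin_le_nhds).congr' ?_
    filter_upwards [self_mem_nhdsWithin] with t ht
    have ht : t ≠ 0 := ht
    rw [slope_def_module, zero_smul, add_zero, exp_add_sub_exp_eq_integral, sub_zero,
      ← intervalIntegral.integral_smul]
    congr 1
    ext s
    simp only [mul_smul_comm, smul_mul_assoc, smul_smul]
    rw [inv_mul_cancel₀ ht, one_smul]
  have hcs : Continuous fun s : ℝ => exp ((1 - s) • A) * B * exp (s • A) := by fun_prop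
  have h3 := ((ContinuousLinearMap.mul ℂ 𝔸).flip (exp (-A))).intervalIntegral_comp_comm
    (hcs.intervalIntegrable (μ := MeasureTheory.volume) 0 1)
  simp only [ContinuousLinearMap.flip_apply, ContinuousLinearMap.mul_apply'] at h3
  rw [h1.unique h2, ← h3, intervalIntegral.integral_of_le zero_le_one]
  have : MeasureTheory.IsProbabilityMeasure
      (MeasureTheory.volume.restrict (Set.Ioc (0 : ℝ) 1)) := ⟨by simp⟩
  -- After multiplication by `exp (-A)` the integrand is the conjugate of `B` by `exp ((1 - s) A)`,
  -- hence lies in `h`. The mean of an `h`-valued function stays in the closed convex set `h`.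
  refine Convex.integral_mem (h.restrictScalars ℝ).convex hc (.of_forall fun s => ?_) ?_
  · have e : exp ((1 - s) • A) * B * exp (s • A) * exp (-A)
        = exp ((1 - s) • A) * B * exp (-((1 - s) • A)) := by
      rw [mul_assoc _ _ (exp (-A)), ← exp_add_of_commute
        (Commute.neg_right ((Commute.refl A).smul_left s))]
      congr 2
      module
    change _ ∈ h
    rw [e]
    exact exp_conj_mem hc hlie ((h.restrictScalars ℝ).smul_mem _ hA) hB
  · have hcs : Continuous fun s : ℝ => exp ((1 - s) • A) * B * exp (s • A) * exp (-A) := by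
      fun_prop
    exact (hcs.intervalIntegrable 0 1).1

end exponential

/-! ### Tangent spaces and local sections of orbits of exponentials. -/

section expOrbit
open NormedSpace Topology
variable {E : Type*} [NormedAddCommGroup E] [NormedSpace ℂ E]

/-- The values at `x` of a space of linear vector fields. -/
noncomputable def infTangent (h : Submodule ℂ (E →L[ℂ] E)) (x : E) : Submodule ℂ E :=
  h.map (ContinuousLinearMap.apply ℂ E x).toLinearMap

/-- The orbit of `p` under the group generated by the exponentials of elements of `h`. -/
inductive ExpOrbit (h : Submodule ℂ (E →L[ℂ] E)) (p : E) : E → Prop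
  | refl : ExpOrbit h p p
  | exp_apply {A : E →L[ℂ] E} {x : E} : A ∈ h → ExpOrbit h p x → ExpOrbit h p (exp A x)

variable {h : Submodule ℂ (E →L[ℂ] E)} {p : E}

variable [FiniteDimensional ℂ E]

/-- One has `exp A (B x) = (exp A * B * exp (-A)) (exp A x)`, and the conjugate of `B` lies in `h`
again. -/
theorem exp_apply_mem_infTangent (hlie : ∀ A ∈ h, ∀ B ∈ h, A * B - B * A ∈ h)
    {A : E →L[ℂ] E} (hA : A ∈ h) {x y : E} (hy : y ∈ infTangent h x) :
    exp A y ∈ infTangent h (exp A x) := by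
  have : CompleteSpace E := FiniteDimensional.complete ℂ E
  obtain ⟨B, hB, rfl⟩ := hy
  refine ⟨_, exp_conj_mem h.closed_of_finiteDimensional hlie hA hB, ?_⟩
  change (exp A * B * exp (-A) * exp A) x = (exp A * B) x
  rw [mul_assoc, exp_neg_mul_exp_of_complex, mul_one]

/-- The injective map `exp A` carries the tangent space at `x` into the one at `exp A x`, and `exp
(-A)` carries it back. Constancy of this dimension along the orbit is what makes the orbit a
manifold of a single dimension. -/
theorem finrank_infTangent_exp_apply (hlie : ∀ A ∈ h, ∀ B ∈ h, A * B - B * A ∈ h)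
    {A : E →L[ℂ] E} (hA : A ∈ h) (x : E) :
    Module.finrank ℂ (infTangent h (exp A x)) = Module.finrank ℂ (infTangent h x) := by
  have : CompleteSpace E := FiniteDimensional.complete ℂ E
  have hle : ∀ {A : E →L[ℂ] E}, A ∈ h → ∀ x : E,
      Module.finrank ℂ (infTangent h x) ≤ Module.finrank ℂ (infTangent h (exp A x)) := by
    intro A hA x
    have hinj : Function.Injective (exp A : E →L[ℂ] E) := by
      refine Function.LeftInverse.injective (g := (exp (-A) : E →L[ℂ] E)) fun y => ?_
      change (exp (-A) * exp A) y = y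
      rw [exp_neg_mul_exp_of_complex]
      rfl
    rw [← LinearMap.finrank_range_of_inj
      (f := (exp A).toLinearMap ∘ₗ (infTangent h x).subtype) (hinj.comp Subtype.val_injective)]
    refine Submodule.finrank_mono ?_
    rintro _ ⟨y, rfl⟩
    exact exp_apply_mem_infTangent hlie hA y.2
  refine le_antisymm ?_ (hle hA x)
  have h1 := hle (h.neg_mem hA) (exp A x)
  have e : exp (-A) (exp A x) = x := by
    change (exp (-A) * exp A) x = x
    rw [exp_neg_mul_exp_of_complex]
    rfl
  rwa [e] at h1

theorem ExpOrbit.finrank_infTangent (hlie : ∀ A ∈ h, ∀ B ∈ h, A * B - B * A ∈ h)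
    {x : E} (hx : ExpOrbit h p x) :
    Module.finrank ℂ (infTangent h x) = Module.finrank ℂ (infTangent h p) := by
  induction hx with
  | refl => rfl
  | exp_apply hA _ ih => rw [finrank_infTangent_exp_apply hlie hA, ih]

section tangential
variable {H : Type*} [NormedAddCommGroup H] [NormedSpace ℂ H]

/-- `f` is differentiable at `u` and its derivative is tangent to the vector fields in `h`. -/
def IsTangential (h : Submodule ℂ (E →L[ℂ] E)) (f : H → E) (u : H) : Prop :=
  DifferentiableAt ℂ f u ∧ ∀ v, fderiv ℂ f u v ∈ infTangent h (f u)

omit [FiniteDimensional ℂ E] in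
theorem IsTangential.comp {H' : Type*} [NormedAddCommGroup H'] [NormedSpace ℂ H']
    {f : H → E} {g : H' → H} {u : H'} (hf : IsTangential h f (g u))
    (hg : DifferentiableAt ℂ g u) : IsTangential h (fun u => f (g u)) u := by
  refine ⟨hf.1.comp u hg, fun v => ?_⟩
  have := fderiv_comp u hf.1 hg
  rw [show (fun u => f (g u)) = f ∘ g from rfl, this]
  exact hf.2 _

/-- The product rule gives two terms. The first is `exp (ι u)` applied to a tangent vector at `f u`.
The second is `C (exp (ι u) (f u))`, where `C` is the derivative of `exp` at `ι u` in the direction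
`ι v`, multiplied by `exp (-ι u)`; it lies in `h` by `fderiv_exp_mem`. -/
theorem IsTangential.exp_apply (hlie : ∀ A ∈ h, ∀ B ∈ h, A * B - B * A ∈ h)
    {f : H → E} {u : H} (hf : IsTangential h f u) {ι : H →L[ℂ] E →L[ℂ] E} (hι : ∀ v, ι v ∈ h) :
    IsTangential h (fun u => exp (ι u) (f u)) u := by
  have : CompleteSpace E := FiniteDimensional.complete ℂ E
  have h1 : HasFDerivAt (fun u => exp (ι u)) ((fderiv ℂ exp (ι u)).comp ι) u :=
    (exp_analytic (𝕂 := ℂ) (ι u)).differentiableAt.hasFDerivAt.comp u ι.hasFDerivAt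
  have h2 := h1.clm_apply hf.1.hasFDerivAt
  refine ⟨h2.differentiableAt, fun v => ?_⟩
  rw [h2.fderiv]
  refine (infTangent h _).add_mem (exp_apply_mem_infTangent hlie (hι u) (hf.2 v)) ?_
  refine ⟨_, fderiv_exp_mem h.closed_of_finiteDimensional hlie (hι u) (hι v), ?_⟩
  change (fderiv ℂ exp (ι u) (ι v) * exp (-ι u) * exp (ι u)) (f u) = fderiv ℂ exp (ι u) (ι v) (f u)
  rw [mul_assoc, exp_neg_mul_exp_of_complex, mul_one]

end tangential

/-- Coordinates on the tangent space at `q` are fixed; `ι` lifts them to `h` through a linear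
section of the evaluation at `q`, and `π` extends them linearly to all of `E`. -/
theorem exists_transversal (h : Submodule ℂ (E →L[ℂ] E)) (q : E) {d : ℕ}
    (hd : Module.finrank ℂ (infTangent h q) = d) :
    ∃ (ι : EuclideanSpace ℂ (Fin d) →L[ℂ] E →L[ℂ] E) (π : E →L[ℂ] EuclideanSpace ℂ (Fin d)),
      (∀ v, ι v ∈ h) ∧ ∀ v, π (ι v q) = v := by
  let e : EuclideanSpace ℂ (Fin d) ≃ₗ[ℂ] infTangent h q :=
    LinearEquiv.ofFinrankEq _ _ (by simp [hd])
  let f : h →ₗ[ℂ] infTangent h q :=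
    ((ContinuousLinearMap.apply ℂ E q).toLinearMap ∘ₗ h.subtype).codRestrict _
      fun A => ⟨A, A.2, rfl⟩
  have hf : LinearMap.range f = ⊤ := by
    refine LinearMap.range_eq_top.mpr ?_
    rintro ⟨_, A, hA, rfl⟩
    exact ⟨⟨A, hA⟩, rfl⟩
  obtain ⟨g, hg⟩ := f.exists_rightInverse_of_surjective hf
  obtain ⟨π, hπ⟩ := e.symm.toLinearMap.exists_extend
  refine ⟨(h.subtype ∘ₗ g ∘ₗ e.toLinearMap).toContinuousLinearMap, π.toContinuousLinearMap,
    fun v => (g (e v)).2, fun v => ?_⟩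
  have h1 : f (g (e v)) = e v := LinearMap.congr_fun hg (e v)
  have h2 : π (f (g (e v)) : E) = e.symm (f (g (e v))) :=
    LinearMap.congr_fun hπ (f (g (e v)))
  rw [h1, e.symm_apply_apply, ← h1] at h2
  exact h2

/-- A holomorphic local section of the linear map `π`, with values in the orbit of `p` and tangent
to the orbit, such that the tangent spaces of the orbit are locally graphs of smooth maps. -/
structure IsLocalSection (h : Submodule ℂ (E →L[ℂ] E)) (p : E) {d : ℕ}
    (π : E →L[ℂ] EuclideanSpace ℂ (Fin d)) (D : Set (EuclideanSpace ℂ (Fin d)))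
    (s : EuclideanSpace ℂ (Fin d) → E) : Prop where
  isOpen : IsOpen D
  contDiffAt : ∀ z ∈ D, ContDiffAt ℂ ω s z
  right_inv : ∀ z ∈ D, π (s z) = z
  mem : ∀ z ∈ D, ExpOrbit h p (s z)
  tangential : ∀ z ∈ D, IsTangential h s z
  graph : ∀ z ∈ D, ∃ T : E → EuclideanSpace ℂ (Fin d) →L[ℂ] E, ContDiffAt ℂ 1 T (s z) ∧
    ∀ᶠ x in 𝓝 (s z), ExpOrbit h p x → ∀ y ∈ infTangent h x, T x (π y) = y

/-- Invertibility of `v ↦ π (ι v x)` is an open condition on `x`, so the vectors `ι v x` span a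
`d`-dimensional subspace of `h x` that projects isomorphically by `π`. If `h x` has dimension
exactly `d`, this subspace is all of it. Away from the orbit `h x` may be larger, hence the
condition on the dimension. -/
theorem exists_graph {d : ℕ} {ι : EuclideanSpace ℂ (Fin d) →L[ℂ] E →L[ℂ] E}
    {π : E →L[ℂ] EuclideanSpace ℂ (Fin d)} (hι : ∀ v, ι v ∈ h) {x₀ : E}
    (hx₀ : IsUnit (π ∘L ι.flip x₀)) :
    ∃ T : E → EuclideanSpace ℂ (Fin d) →L[ℂ] E, ContDiffAt ℂ 1 T x₀ ∧
      ∀ᶠ x in 𝓝 x₀, Module.finrank ℂ (infTangent h x) = d →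
        ∀ y ∈ infTangent h x, T x (π y) = y := by
  have hsm : ContDiffAt ℂ 1 (fun x => π ∘L ι.flip x) x₀ :=
    contDiffAt_const.clm_comp ι.flip.contDiff.contDiffAt
  refine ⟨fun x => ι.flip x ∘L Ring.inverse (π ∘L ι.flip x), ?_, ?_⟩
  · obtain ⟨u, hu⟩ := hx₀
    have h1 := contDiffAt_ringInverse ℂ (n := 1) u
    rw [hu] at h1
    exact ι.flip.contDiff.contDiffAt.clm_comp
      (ContDiffAt.comp (f := fun x => π ∘L ι.flip x) x₀ h1 hsm)
  · filter_upwards [hsm.continuousAt.preimage_mem_nhds (Units.isOpen.mem_nhds hx₀)]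
      with x hx hd y hy
    have hx : IsUnit (π ∘L ι.flip x) := hx
    have hinv : ∀ v, Ring.inverse (π ∘L ι.flip x) (π (ι v x)) = v := fun v => by
      change (Ring.inverse (π ∘L ι.flip x) * (π ∘L ι.flip x)) v = v
      rw [Ring.inverse_mul_cancel _ hx]
      rfl
    have hle : LinearMap.range (ι.flip x).toLinearMap ≤ infTangent h x := by
      rintro _ ⟨v, rfl⟩
      exact ⟨ι v, hι v, rfl⟩
    have hinj : Function.Injective (ι.flip x).toLinearMap := by
      intro v w hvw
      have hvw : ι v x = ι w x := hvw
      rw [← hinv v, hvw, hinv w]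
    have heq := Submodule.eq_of_le_of_finrank_eq hle (by
      rw [LinearMap.finrank_range_of_inj hinj, hd]; simp)
    rw [← heq] at hy
    obtain ⟨v, rfl⟩ := hy
    change ι (Ring.inverse (π ∘L ι.flip x) (π (ι v x))) x = ι v x
    rw [hinv]

/-- The map `F v = exp (ι v) q` stays in the orbit and is tangential. Composing it with a local
inverse of `π ∘ F` turns it into a section of `π`. -/
theorem exists_isLocalSection (hlie : ∀ A ∈ h, ∀ B ∈ h, A * B - B * A ∈ h) {d : ℕ}
    (hd : Module.finrank ℂ (infTangent h p) = d) {q : E} (hq : ExpOrbit h p q) :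
    ∃ (π : E →L[ℂ] EuclideanSpace ℂ (Fin d)) (D : Set (EuclideanSpace ℂ (Fin d)))
      (s : EuclideanSpace ℂ (Fin d) → E), IsLocalSection h p π D s ∧ π q ∈ D ∧ s (π q) = q := by
  have : CompleteSpace E := FiniteDimensional.complete ℂ E
  obtain ⟨ι, π, hι, hπ⟩ := exists_transversal h q ((hq.finrank_infTangent hlie).trans hd)
  set F : EuclideanSpace ℂ (Fin d) → E := fun v => exp (ι v) q with hF
  have hFc : ∀ v, ContDiffAt ℂ ω F v := fun v =>
    (((exp_analytic (𝕂 := ℂ) (ι v)).contDiffAt).comp v ι.contDiff.contDiffAt).clm_apply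
      contDiffAt_const
  have hF0 : F 0 = q := by simp [hF]
  have hFt : ∀ v, IsTangential h F v := fun v =>
    IsTangential.exp_apply hlie (f := fun _ => q)
      ⟨differentiableAt_const q, fun w => by simp⟩ hι
  have hK : ContDiffAt ℂ ω (fun v => π (F v)) 0 := π.contDiff.contDiffAt.comp 0 (hFc 0)
  -- The derivative of `exp` at `0` is the identity, so `π ∘ F` has derivative `v ↦ π (ι v q) = v`
  -- at `0` and the inverse function theorem applies.
  have hK' : HasFDerivAt (fun v => π (F v))
      (ContinuousLinearEquiv.refl ℂ (EuclideanSpace ℂ (Fin d)) :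
        EuclideanSpace ℂ (Fin d) →L[ℂ] EuclideanSpace ℂ (Fin d)) 0 := by
    have h0 : HasFDerivAt (exp : (E →L[ℂ] E) → E →L[ℂ] E) (1 : (E →L[ℂ] E) →L[ℂ] E →L[ℂ] E)
        (ι 0) := by
      rw [map_zero]; exact hasFDerivAt_exp_zero
    have h1 := π.hasFDerivAt.comp (0 : EuclideanSpace ℂ (Fin d))
      ((h0.comp _ ι.hasFDerivAt).clm_apply (hasFDerivAt_const q _))
    refine h1.congr_fderiv ?_
    ext1 v
    simp [hπ]
  set κ := hK.localInverse hK' (by simp) with hκ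
  have hκc : ContDiffAt ℂ ω κ (π q) := by
    have := hK.to_localInverse hK' (by simp)
    rwa [hF0] at this
  have hκ0 : κ (π q) = 0 := by
    have := hK.localInverse_apply_image hK' (by simp)
    rwa [hF0] at this
  have hright : ∀ᶠ z in 𝓝 (π q), π (F (κ z)) = z := by
    have := (hK.hasStrictFDerivAt' hK' (by simp)).eventually_right_inverse
    rwa [hF0] at this
  have hsq : F (κ (π q)) = q := by rw [hκ0, hF0]
  have hunit : ∀ᶠ z in 𝓝 (π q), IsUnit (π ∘L ι.flip (F (κ z))) := by
    have hc : ContinuousAt (fun z => π ∘L ι.flip (F (κ z))) (π q) := by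
      have h1 : ContinuousAt (fun z => F (κ z)) (π q) :=
        ContinuousAt.comp (f := κ) (g := F) (hFc _).continuousAt hκc.continuousAt
      exact continuousAt_const.clm_comp (ι.flip.continuous.continuousAt.comp h1)
    refine hc.preimage_mem_nhds (Units.isOpen.mem_nhds ?_)
    rw [hsq]
    have e1 : π ∘L ι.flip q = 1 := by
      ext1 v
      simp [hπ]
    exact e1 ▸ isUnit_one
  -- The domain `D` is shrunk so that on it the section identity holds, the hypothesis of
  -- `exists_graph` is satisfied, and the local inverse is analytic.
  have hall := (hright.and hunit).and (hκc.eventually (by simp))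
  obtain ⟨D, hD, hDo, hqD⟩ := mem_nhds_iff.mp hall
  refine ⟨π, D, fun z => F (κ z), ⟨hDo, fun z hz => (hFc _).comp z (hD hz).2,
    fun z hz => (hD hz).1.1, fun z _ => hq.exp_apply (hι _),
    fun z hz => (hFt _).comp ((hD hz).2.differentiableAt (by simp)), fun z hz => ?_⟩, hqD, hsq⟩
  obtain ⟨T, hT, hT'⟩ := exists_graph hι (hD hz).1.2
  refine ⟨T, hT, ?_⟩
  filter_upwards [hT'] with x hx hxo
  exact hx ((hxo.finrank_infTangent hlie).trans hd)

end expOrbit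

/-! ### Uniqueness of tangential maps through a point. -/

section
open NormedSpace Topology
variable {E : Type*} [NormedAddCommGroup E] [NormedSpace ℂ E] [FiniteDimensional ℂ E]
  {h : Submodule ℂ (E →L[ℂ] E)} {p : E}

omit [FiniteDimensional ℂ E] in
/-- A tangential map into the orbit which meets the image of a local section stays in it. -/
theorem IsLocalSection.eventually_eq {d : ℕ} {π : E →L[ℂ] EuclideanSpace ℂ (Fin d)}
    {D : Set (EuclideanSpace ℂ (Fin d))} {s : EuclideanSpace ℂ (Fin d) → E}
    (hs : IsLocalSection h p π D s) {H : Type*} [NormedAddCommGroup H] [NormedSpace ℂ H]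
    {f : H → E} {u₀ : H} (hf : ContDiffAt ℂ 1 f u₀)
    (hft : ∀ᶠ u in 𝓝 u₀, ExpOrbit h p (f u) ∧ IsTangential h f u)
    {z₀ : EuclideanSpace ℂ (Fin d)} (hz₀ : z₀ ∈ D) (hfz : f u₀ = s z₀) :
    ∀ᶠ u in 𝓝 u₀, π (f u) ∈ D ∧ s (π (f u)) = f u := by
  -- Being `C^1`, the field `T` is Lipschitz near `s z₀`. It recovers a vector tangent to the orbit
  -- from its projection, so it plays the role of the right-hand side of a differential equation.
  obtain ⟨T, hT, hTg⟩ := hs.graph z₀ hz₀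
  obtain ⟨K, U, hU, hK⟩ := hT.exists_lipschitzOnWith
  have hfc : ContinuousAt f u₀ := hf.continuousAt
  have hπz : π (f u₀) = z₀ := by rw [hfz, hs.right_inv _ hz₀]
  have hπc : ContinuousAt (fun u => π (f u)) u₀ := π.continuous.continuousAt.comp hfc
  have hsc : Filter.Tendsto (fun u => s (π (f u))) (𝓝 u₀) (𝓝 (s z₀)) :=
    (hs.contDiffAt z₀ hz₀).continuousAt.tendsto.comp (hπz ▸ hπc.tendsto)
  have e0 : s (π (f u₀)) = s z₀ := by rw [hπz]
  obtain ⟨C, hC⟩ : ∃ C : ℝ, ∀ᶠ u in 𝓝 u₀, ‖fderiv ℂ f u‖ ≤ C := by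
    have hd : ContinuousAt (fderiv ℂ f) u₀ :=
      (hf.fderiv_right (m := 0) (by simp)).continuousAt
    refine ⟨‖fderiv ℂ f u₀‖ + 1, ?_⟩
    filter_upwards [hd.norm.eventually_lt continuousAt_const (lt_add_one _)] with u hu
    exact hu.le
  have h1 : ∀ᶠ u in 𝓝 u₀, f u ∈ U ∧ (ExpOrbit h p (f u) →
      ∀ y ∈ infTangent h (f u), T (f u) (π y) = y) :=
    hfc.eventually (by rw [hfz]; exact hU) |>.and (hfc.eventually (by rw [hfz]; exact hTg))
  have h2 : ∀ᶠ u in 𝓝 u₀, s (π (f u)) ∈ U ∧ (ExpOrbit h p (s (π (f u))) →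
      ∀ y ∈ infTangent h (s (π (f u))), T (s (π (f u))) (π y) = y) :=
    (hsc.eventually hU).and (hsc.eventually hTg)
  have h3 : ∀ᶠ u in 𝓝 u₀, π (f u) ∈ D :=
    hπc.eventually (hs.isOpen.mem_nhds (by simpa only [hπz] using hz₀))
  obtain ⟨r, hr, hball⟩ := Metric.eventually_nhds_iff_ball.mp
    (((h1.and h2).and (h3.and hC)).and hft)
  filter_upwards [Metric.ball_mem_nhds u₀ hr] with u hu
  refine ⟨(hball u hu).1.2.1, ?_⟩
  -- Along the segment from `u₀` to `u`, the curve `f ∘ γ` is compared with its lift `s ∘ π ∘ f ∘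
  -- γ`. Their difference vanishes at `t = 0`, and Grönwall's inequality forces it to vanish at `t =
  -- 1`.
  let γ : ℝ → H := fun t => u₀ + t • (u - u₀)
  have hγ : ∀ t ∈ Set.Icc (0 : ℝ) 1, γ t ∈ Metric.ball u₀ r := by
    intro t ht
    rw [mem_ball_iff_norm] at hu ⊢
    change ‖u₀ + t • (u - u₀) - u₀‖ < r
    rw [add_sub_cancel_left, norm_smul, Real.norm_of_nonneg ht.1]
    exact (mul_le_of_le_one_left (norm_nonneg _) ht.2).trans_lt hu
  have hγd : ∀ t, HasDerivAt γ (u - u₀) t := fun t =>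
    (((hasDerivAt_id t).smul_const (u - u₀)).const_add u₀).congr_deriv (one_smul _ _)
  have hg : ∀ t ∈ Set.Icc (0 : ℝ) 1, HasDerivAt (fun t => f (γ t) - s (π (f (γ t))))
      (fderiv ℂ f (γ t) (u - u₀) -
        fderiv ℂ s (π (f (γ t))) (π (fderiv ℂ f (γ t) (u - u₀)))) t := by
    intro t ht
    obtain ⟨⟨_, hD, _⟩, _, hft'⟩ := hball _ (hγ t ht)
    have d1 : HasDerivAt (fun t => f (γ t)) (fderiv ℂ f (γ t) (u - u₀)) t :=
      (hft'.1.hasFDerivAt.restrictScalars ℝ).comp_hasDerivAt t (hγd t)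
    have d2 : HasDerivAt (fun t => π (f (γ t))) (π (fderiv ℂ f (γ t) (u - u₀))) t :=
      (π.restrictScalars ℝ).hasFDerivAt.comp_hasDerivAt t d1
    have d3 : HasDerivAt (fun t => s (π (f (γ t))))
        (fderiv ℂ s (π (f (γ t))) (π (fderiv ℂ f (γ t) (u - u₀)))) t :=
      ((hs.tangential _ hD).1.hasFDerivAt.restrictScalars ℝ).comp_hasDerivAt (f := fun t => π (f (γ t))) t d2
    exact d1.sub d3
  have hbound : ∀ t ∈ Set.Ico (0 : ℝ) 1, ‖fderiv ℂ f (γ t) (u - u₀) -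
        fderiv ℂ s (π (f (γ t))) (π (fderiv ℂ f (γ t) (u - u₀)))‖ ≤
      (K * (‖π‖ * (C * ‖u - u₀‖))) * ‖f (γ t) - s (π (f (γ t)))‖ := by
    intro t ht
    obtain ⟨⟨⟨⟨hU1, hT1⟩, hU2, hT2⟩, hD, hC'⟩, ho, hft'⟩ := hball _ (hγ t (Set.Ico_subset_Icc_self ht))
    set y := fderiv ℂ f (γ t) (u - u₀) with hy
    have e1 := hT1 ho y (hft'.2 _)
    have e2 := hT2 (hs.mem _ hD) _ ((hs.tangential _ hD).2 (π y))
    -- Differentiating `π ∘ s = id` shows that both velocities have the same projection `π y`. They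
    -- are therefore the values of `T` at the two points on the same vector, and differ by at most
    -- the Lipschitz constant times the distance of the points times `‖π y‖`.
    have e3 : π (fderiv ℂ s (π (f (γ t))) (π y)) = π y := by
      have hd : HasFDerivAt (fun z => π (s z)) (π ∘L fderiv ℂ s (π (f (γ t)))) (π (f (γ t))) :=
        π.hasFDerivAt.comp _ (hs.tangential _ hD).1.hasFDerivAt
      have hd' : HasFDerivAt (fun z => π (s z)) (ContinuousLinearMap.id ℂ _) (π (f (γ t))) := by
        refine (hasFDerivAt_id _).congr_of_eventuallyEq ?_
        filter_upwards [hs.isOpen.mem_nhds hD] with z hz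
        exact hs.right_inv z hz
      exact congrArg (fun L => L (π y)) (hd.unique hd')
    rw [e3] at e2
    calc _ = ‖(T (f (γ t)) - T (s (π (f (γ t))))) (π y)‖ := by
          rw [_root_.sub_apply, e1, e2]
      _ ≤ ‖T (f (γ t)) - T (s (π (f (γ t))))‖ * ‖π y‖ := ContinuousLinearMap.le_opNorm _ _
      _ ≤ (K * ‖f (γ t) - s (π (f (γ t)))‖) * (‖π‖ * (C * ‖u - u₀‖)) := by
          gcongr
          · exact hK.norm_sub_le hU1 hU2
          · refine (π.le_opNorm y).trans ?_
            gcongr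
            refine ((fderiv ℂ f (γ t)).le_opNorm _).trans ?_
            gcongr
      _ = _ := by ring
  have h0 : γ 0 = u₀ := by simp [γ]
  have h1' : γ 1 = u := by simp [γ]
  have hfin := eq_zero_of_abs_deriv_le_mul_abs_self_of_eq_zero_right
    (f := fun t => f (γ t) - s (π (f (γ t)))) (a := 0) (b := 1)
    (fun t ht => (hg t ht).continuousAt.continuousWithinAt)
    (fun t ht => (hg t (Set.Ico_subset_Icc_self ht)).hasDerivWithinAt)
    (by simp only [h0]; rw [e0, hfz, sub_self]) hbound 1 (by simp)
  simp only [h1'] at hfin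
  exact (sub_eq_zero.mp hfin).symm

end

/-! ### The manifold structure defined by an atlas of local sections. -/

section
open Topology

/-- A family of holomorphic local parametrizations of a subset `S` of `E`, whose inverses are
restrictions of linear maps. -/
structure SectionAtlas {E : Type} [NormedAddCommGroup E] [NormedSpace ℂ E] (S : Set E) (d : ℕ) where
  proj : S → E →L[ℂ] EuclideanSpace ℂ (Fin d)
  dom : S → Set (EuclideanSpace ℂ (Fin d))
  sec : S → EuclideanSpace ℂ (Fin d) → E
  isOpen_dom : ∀ q, IsOpen (dom q)
  contDiffAt_sec : ∀ q, ∀ z ∈ dom q, ContDiffAt ℂ ω (sec q) z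
  proj_sec : ∀ q, ∀ z ∈ dom q, proj q (sec q z) = z
  sec_mem : ∀ q, ∀ z ∈ dom q, sec q z ∈ S
  proj_mem : ∀ q, proj q q ∈ dom q
  sec_proj : ∀ q, sec q (proj q q) = q
  eventually_eq : ∀ q q', ∀ z ∈ dom q, proj q' (sec q z) ∈ dom q' →
    sec q' (proj q' (sec q z)) = sec q z →
    ∀ᶠ z' in 𝓝 z, proj q' (sec q z') ∈ dom q' ∧ sec q' (proj q' (sec q z')) = sec q z'

namespace SectionAtlas
variable {E : Type} [NormedAddCommGroup E] [NormedSpace ℂ E] {S : Set E} {d : ℕ}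
  (A : SectionAtlas S d)

/-- The set `S`, to be endowed with the topology defined by the atlas. -/
@[ext]
structure Leaf (A : SectionAtlas S d) : Type where
  pt : S

/-- The inclusion in the ambient space. -/
def val (x : A.Leaf) : E := x.pt

theorem val_mem (x : A.Leaf) : A.val x ∈ S := x.pt.2

theorem val_injective : Function.Injective A.val := fun _ _ h => Leaf.ext (Subtype.ext h)

theorem range_val : Set.range A.val = S :=
  Set.Subset.antisymm (by rintro _ ⟨x, rfl⟩; exact A.val_mem x) fun x hx => ⟨⟨⟨x, hx⟩⟩, rfl⟩

open Classical in
/-- The chart given by a local section. -/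
noncomputable def chart (q : S) : PartialEquiv A.Leaf (EuclideanSpace ℂ (Fin d)) where
  toFun x := A.proj q (A.val x)
  invFun z := if h : z ∈ A.dom q then ⟨⟨A.sec q z, A.sec_mem q z h⟩⟩ else ⟨q⟩
  source := {x | A.proj q (A.val x) ∈ A.dom q ∧ A.sec q (A.proj q (A.val x)) = A.val x}
  target := A.dom q
  map_source' x hx := hx.1
  map_target' z hz := by
    rw [dif_pos hz]
    change A.proj q (A.sec q z) ∈ A.dom q ∧ A.sec q (A.proj q (A.sec q z)) = A.sec q z
    rw [A.proj_sec q z hz]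
    exact ⟨hz, rfl⟩
  left_inv' x hx := by
    rw [dif_pos hx.1]
    exact A.val_injective hx.2
  right_inv' z hz := by
    rw [dif_pos hz]
    exact A.proj_sec q z hz

theorem mem_source {q : S} {x : A.Leaf} : x ∈ (A.chart q).source ↔
    A.proj q (A.val x) ∈ A.dom q ∧ A.sec q (A.proj q (A.val x)) = A.val x := Iff.rfl

open Classical in
theorem val_chart_symm {q : S} {z : EuclideanSpace ℂ (Fin d)} (hz : z ∈ A.dom q) :
    A.val ((A.chart q).symm z) = A.sec q z := by
  change A.val (dite _ _ _) = _
  rw [dif_pos hz]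
  rfl

theorem mem_trans_source {q q' : S} {z : EuclideanSpace ℂ (Fin d)} :
    z ∈ ((A.chart q).symm.trans (A.chart q')).source ↔ z ∈ A.dom q ∧
      A.proj q' (A.sec q z) ∈ A.dom q' ∧ A.sec q' (A.proj q' (A.sec q z)) = A.sec q z := by
  rw [PartialEquiv.trans_source, Set.mem_inter_iff]
  change z ∈ A.dom q ∧ (A.chart q).symm z ∈ (A.chart q').source ↔ _
  refine and_congr_right fun hz => ?_
  rw [mem_source, A.val_chart_symm hz]

/-- This is what `eventually_eq` is for: if the images of two sections meet at a point, they
coincide near it, so the overlap is open in the coordinates of either chart. -/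
theorem isOpen_trans_source (q q' : S) :
    IsOpen ((A.chart q).symm.trans (A.chart q')).source := by
  refine isOpen_iff_mem_nhds.mpr fun z hz => ?_
  rw [mem_trans_source] at hz
  filter_upwards [(A.isOpen_dom q).mem_nhds hz.1,
    A.eventually_eq q q' z hz.1 hz.2.1 hz.2.2] with z' h1 h2
  rw [mem_trans_source]
  exact ⟨h1, h2⟩

/-- The coordinate change is a section followed by a linear projection, so it is analytic as soon as
the sections are. -/
theorem contDiffOn_trans (q q' : S) : ContDiffOn ℂ ω ((A.chart q).symm.trans (A.chart q'))
    ((A.chart q).symm.trans (A.chart q')).source := by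
  have h1 : ContDiffOn ℂ ω (fun z => A.proj q' (A.sec q z))
      ((A.chart q).symm.trans (A.chart q')).source := fun z hz =>
    ((A.proj q').contDiff.contDiffAt.comp z
      (A.contDiffAt_sec q z (A.mem_trans_source.mp hz).1)).contDiffWithinAt
  refine h1.congr fun z hz => ?_
  change A.proj q' (A.val ((A.chart q).symm z)) = _
  rw [A.val_chart_symm (A.mem_trans_source.mp hz).1]

/-- The charts define a topology and a manifold structure. -/
noncomputable def core : ChartedSpaceCore (EuclideanSpace ℂ (Fin d)) A.Leaf where
  atlas := Set.range A.chart
  chartAt x := A.chart x.pt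
  mem_chart_source x := ⟨A.proj_mem x.pt, A.sec_proj x.pt⟩
  chart_mem_atlas x := ⟨x.pt, rfl⟩
  open_source := by
    rintro _ _ ⟨q, rfl⟩ ⟨q', rfl⟩
    exact A.isOpen_trans_source q q'
  continuousOn_toFun := by
    rintro _ _ ⟨q, rfl⟩ ⟨q', rfl⟩
    exact (A.contDiffOn_trans q q').continuousOn

noncomputable instance : TopologicalSpace A.Leaf := A.core.toTopologicalSpace

noncomputable instance : ChartedSpace (EuclideanSpace ℂ (Fin d)) A.Leaf := A.core.toChartedSpace

/-- The charts as homeomorphisms. -/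
noncomputable def chartHomeo (q : S) :
    OpenPartialHomeomorph A.Leaf (EuclideanSpace ℂ (Fin d)) :=
  A.core.openPartialHomeomorph (A.chart q) ⟨q, rfl⟩

theorem exists_of_mem_atlas {e : OpenPartialHomeomorph A.Leaf (EuclideanSpace ℂ (Fin d))}
    (he : e ∈ atlas (EuclideanSpace ℂ (Fin d)) A.Leaf) : ∃ q, e = A.chartHomeo q := by
  change e ∈ ⋃ (e : PartialEquiv _ _) (he : e ∈ A.core.atlas), {A.core.openPartialHomeomorph e he} at he
  simp only [Set.mem_iUnion, Set.mem_singleton_iff] at he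
  obtain ⟨_, ⟨q, rfl⟩, h⟩ := he
  exact ⟨q, h⟩

instance : IsManifold 𝓘(ℂ, EuclideanSpace ℂ (Fin d)) ω A.Leaf := by
  refine isManifold_of_contDiffOn _ _ _ fun e e' he he' => ?_
  obtain ⟨q, rfl⟩ := A.exists_of_mem_atlas he
  obtain ⟨q', rfl⟩ := A.exists_of_mem_atlas he'
  refine (A.contDiffOn_trans q q').mono ?_
  intro z hz
  exact hz.1

/-- Near `x` the inclusion is the chart at `x` followed by the section that defines this chart. -/
theorem contMDiff_val : ContMDiff 𝓘(ℂ, EuclideanSpace ℂ (Fin d)) 𝓘(ℂ, E) ω A.val := by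
  intro x
  have h1 : ContMDiffAt 𝓘(ℂ, EuclideanSpace ℂ (Fin d)) 𝓘(ℂ, EuclideanSpace ℂ (Fin d)) ω
      (chartAt (EuclideanSpace ℂ (Fin d)) x) x :=
    contMDiffAt_of_mem_maximalAtlas (IsManifold.chart_mem_maximalAtlas x) (mem_chart_source _ x)
  have h2 : ContMDiffAt 𝓘(ℂ, EuclideanSpace ℂ (Fin d)) 𝓘(ℂ, E) ω (A.sec x.pt)
      (chartAt (EuclideanSpace ℂ (Fin d)) x x) :=
    (A.contDiffAt_sec x.pt _ (A.proj_mem x.pt)).contMDiffAt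
  refine (h2.comp x h1).congr_of_eventuallyEq ?_
  filter_upwards [(chartAt (EuclideanSpace ℂ (Fin d)) x).open_source.mem_nhds
    (mem_chart_source _ x)] with y hy
  exact (show y ∈ (A.chart x.pt).source from hy).2.symm

theorem continuous_val : Continuous A.val := A.contMDiff_val.continuous

instance : T2Space A.Leaf := T2Space.of_injective_continuous A.val_injective A.continuous_val

/-- The inclusion followed by the linear projection at `x` is the chart at `x`, whose derivative is
injective. -/
theorem mfderiv_val_injective (x : A.Leaf) :
    Function.Injective (mfderiv 𝓘(ℂ, EuclideanSpace ℂ (Fin d)) 𝓘(ℂ, E) A.val x) := by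
  have h1 := (mdifferentiable_chart (I := 𝓘(ℂ, EuclideanSpace ℂ (Fin d))) x).mfderiv_injective
    (mem_chart_source _ x)
  have h2 : mfderiv 𝓘(ℂ, EuclideanSpace ℂ (Fin d)) 𝓘(ℂ, EuclideanSpace ℂ (Fin d))
      (A.proj x.pt ∘ A.val) x = (mfderiv 𝓘(ℂ, E) 𝓘(ℂ, EuclideanSpace ℂ (Fin d)) (A.proj x.pt) (A.val x)).comp
        (mfderiv 𝓘(ℂ, EuclideanSpace ℂ (Fin d)) 𝓘(ℂ, E) A.val x) :=
    mfderiv_comp x (A.proj x.pt).mdifferentiableAt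
      (A.contMDiff_val.mdifferentiable (by simp) x)
  have h3 : (A.proj x.pt ∘ A.val) = chartAt (EuclideanSpace ℂ (Fin d)) x := rfl
  rw [← h3, h2] at h1
  exact Function.Injective.of_comp h1

/-- Continuity into `E` alone is not enough, since the topology of the leaf may be finer than that
of `E`. If moreover `f` stays in one chart domain, it is the inverse chart applied to the projection
of its value in `E`. -/
theorem continuousAt_of_proj {X : Type*} [TopologicalSpace X] {f : X → A.Leaf} {x : X} (q : S)
    (hf : ContinuousAt (fun y => A.val (f y)) x)
    (hq : ∀ᶠ y in 𝓝 x, A.proj q (A.val (f y)) ∈ A.dom q ∧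
      A.sec q (A.proj q (A.val (f y))) = A.val (f y)) : ContinuousAt f x := by
  have hx := hq.self_of_nhds
  have h1 : ContinuousAt (A.chartHomeo q).symm (A.proj q (A.val (f x))) :=
    (A.chartHomeo q).continuousAt_symm hx.1
  have h2 : ContinuousAt (fun y => A.proj q (A.val (f y))) x :=
    (A.proj q).continuous.continuousAt.comp hf
  have h3 : ContinuousAt (fun y => (A.chartHomeo q).symm (A.proj q (A.val (f y)))) x :=
    ContinuousAt.comp (f := fun y => A.proj q (A.val (f y))) h1 h2
  refine h3.congr ?_
  filter_upwards [hq] with y hy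
  exact (A.chartHomeo q).left_inv (x := f y) hy

/-- Only second countability is not automatic; it follows from σ-compactness, countably many charts
then being sufficient to cover the leaf. -/
theorem isImmersedSubmanifold [SigmaCompactSpace A.Leaf] : IsImmersedSubmanifold S d :=
  ⟨A.Leaf, inferInstance, inferInstance, inferInstance, A.val, inferInstance,
    ChartedSpace.secondCountable_of_sigmaCompact (EuclideanSpace ℂ (Fin d)) A.Leaf,
    A.contMDiff_val, A.mfderiv_val_injective, A.val_injective, A.range_val⟩

end SectionAtlas
end

/-! ### Orbits of exponentials as second countable immersed submanifolds. -/

section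
open NormedSpace Topology
variable {E : Type} [NormedAddCommGroup E] [NormedSpace ℂ E] [FiniteDimensional ℂ E]
  {h : Submodule ℂ (E →L[ℂ] E)} {p : E} {d : ℕ}

theorem exists_sectionAtlas (hlie : ∀ A ∈ h, ∀ B ∈ h, A * B - B * A ∈ h)
    (hd : Module.finrank ℂ (infTangent h p) = d) :
    ∃ A : SectionAtlas {x | ExpOrbit h p x} d,
      ∀ q, IsLocalSection h p (A.proj q) (A.dom q) (A.sec q) := by
  choose π D s hs hq hsq using
    fun q : {x | ExpOrbit h p x} => exists_isLocalSection hlie hd q.2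
  refine ⟨⟨π, D, s, fun q => (hs q).isOpen, fun q => (hs q).contDiffAt,
    fun q => (hs q).right_inv, fun q => (hs q).mem, hq, hsq, fun q q' z hz hz' he => ?_⟩, hs⟩
  refine (hs q').eventually_eq (((hs q).contDiffAt z hz).of_le (by simp)) ?_ hz' he.symm
  filter_upwards [(hs q).isOpen.mem_nhds hz] with z' h'
  exact ⟨(hs q).mem z' h', (hs q).tangential z' h'⟩

variable {A : SectionAtlas {x | ExpOrbit h p x} d}

/-- The action of the exponentials of elements of `h` on the orbit. -/
noncomputable def expAct (A : SectionAtlas {x | ExpOrbit h p x} d) (y : h × A.Leaf) : A.Leaf :=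
  ⟨⟨exp (y.1 : E →L[ℂ] E) (A.val y.2), (A.val_mem y.2 : ExpOrbit h p _).exp_apply y.1.2⟩⟩

omit [FiniteDimensional ℂ E] in
theorem val_expAct (y : h × A.Leaf) : A.val (expAct A y) = exp (y.1 : E →L[ℂ] E) (A.val y.2) := rfl

theorem continuous_expAct (hlie : ∀ A ∈ h, ∀ B ∈ h, A * B - B * A ∈ h)
    (hA : ∀ q, IsLocalSection h p (A.proj q) (A.dom q) (A.sec q)) : Continuous (expAct A) := by
  have : CompleteSpace E := FiniteDimensional.complete ℂ E
  let _ : NormedAlgebra ℚ (E →L[ℂ] E) := .restrictScalars ℚ ℂ (E →L[ℂ] E)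
  have hval : Continuous fun y => A.val (expAct A y) := by
    have h1 : Continuous fun y : h × A.Leaf => exp (y.1 : E →L[ℂ] E) :=
      exp_continuous.comp (continuous_subtype_val.comp continuous_fst)
    exact h1.clm_apply (A.continuous_val.comp continuous_snd)
  rw [continuous_iff_continuousAt]
  rintro ⟨y₀, x₀⟩
  set q := (expAct A (y₀, x₀)).pt with hq
  refine A.continuousAt_of_proj q hval.continuousAt ?_
  -- This is the action read in the chart at `x₀`. It is tangential with values in the orbit, so the
  -- uniqueness statement confines it to the chart at the image point `q`, as `continuousAt_of_proj`
  -- requires.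
  let f : h × EuclideanSpace ℂ (Fin d) → E := fun u => exp (u.1 : E →L[ℂ] E) (A.sec x₀.pt u.2)
  have hx₀ : A.sec x₀.pt (A.proj x₀.pt (A.val x₀)) = A.val x₀ := A.sec_proj x₀.pt
  let ι : (h × EuclideanSpace ℂ (Fin d)) →L[ℂ] E →L[ℂ] E :=
    h.subtypeL.comp (ContinuousLinearMap.fst ℂ _ _)
  have hι : ∀ v, ι v ∈ h := fun v => v.1.2
  have hsnd : ContDiff ℂ ω (Prod.snd : h × EuclideanSpace ℂ (Fin d) → _) := contDiff_snd
  have hιc : ContDiff ℂ 1 fun u : h × EuclideanSpace ℂ (Fin d) => ι u := by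
    change ContDiff ℂ 1 fun u : h × EuclideanSpace ℂ (Fin d) => h.subtypeL u.1
    fun_prop
  have hf : ContDiffAt ℂ 1 f (y₀, A.proj x₀.pt (A.val x₀)) := by
    have h1 : ContDiffAt ℂ 1 (fun u => exp (ι u)) (y₀, A.proj x₀.pt (A.val x₀)) :=
      ((exp_analytic (𝕂 := ℂ) _).contDiffAt).comp _ hιc.contDiffAt
    have h2 : ContDiffAt ℂ 1 (fun u : h × EuclideanSpace ℂ (Fin d) => A.sec x₀.pt u.2)
        (y₀, A.proj x₀.pt (A.val x₀)) :=
      ContDiffAt.comp (f := Prod.snd) (y₀, A.proj x₀.pt (A.val x₀))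
        ((A.contDiffAt_sec x₀.pt _ (A.proj_mem x₀.pt)).of_le (by simp)) (hsnd.contDiffAt.of_le (by simp))
    exact h1.clm_apply h2
  have hft : ∀ᶠ u in 𝓝 (y₀, A.proj x₀.pt (A.val x₀)), ExpOrbit h p (f u) ∧ IsTangential h f u := by
    have : ∀ᶠ u : h × EuclideanSpace ℂ (Fin d) in 𝓝 (y₀, A.proj x₀.pt (A.val x₀)),
        u.2 ∈ A.dom x₀.pt :=
      continuousAt_snd.eventually ((A.isOpen_dom x₀.pt).mem_nhds (A.proj_mem x₀.pt))
    filter_upwards [this] with u hu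
    exact ⟨((hA _).mem _ hu).exp_apply u.1.2,
      IsTangential.exp_apply hlie
        (IsTangential.comp (g := Prod.snd) ((hA _).tangential _ hu) differentiableAt_snd) hι⟩
  have hev := (hA q).eventually_eq hf hft (A.proj_mem q) (by
    change exp (y₀ : E →L[ℂ] E) (A.sec x₀.pt (A.proj x₀.pt (A.val x₀))) = _
    rw [hx₀, A.sec_proj q]
    rfl)
  have hc : ContinuousAt (fun y : h × A.Leaf => (y.1, A.proj x₀.pt (A.val y.2))) (y₀, x₀) :=
    (continuous_fst.prodMk ((A.proj x₀.pt).continuous.comp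
      (A.continuous_val.comp continuous_snd))).continuousAt
  have hsrc : ∀ᶠ y : h × A.Leaf in 𝓝 (y₀, x₀), y.2 ∈ (A.chartHomeo x₀.pt).source :=
    continuousAt_snd.eventually ((A.chartHomeo x₀.pt).open_source.mem_nhds
      (show x₀ ∈ (A.chart x₀.pt).source from ⟨A.proj_mem x₀.pt, A.sec_proj x₀.pt⟩))
  filter_upwards [hc.eventually hev, hsrc] with y hy hy'
  have e1 : f (y.1, A.proj x₀.pt (A.val y.2)) = A.val (expAct A y) := by
    change exp (y.1 : E →L[ℂ] E) (A.sec x₀.pt (A.proj x₀.pt (A.val y.2))) = _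
    rw [(show y.2 ∈ (A.chart x₀.pt).source from hy').2, val_expAct]
  rwa [e1] at hy

/-- An exhaustion of the orbit by compact sets. -/
noncomputable def expOrbitExhaustion (A : SectionAtlas {x | ExpOrbit h p x} d) : ℕ → Set A.Leaf
  | 0 => {⟨⟨p, .refl⟩⟩}
  | n + 1 => expAct A '' (Metric.closedBall 0 n ×ˢ expOrbitExhaustion A n)

/-- Each orbit point is reached from `p` by finitely many exponentials of elements of bounded norm.
Those reached with given bounds form the image of a compact set under the action, which is
continuous for the topology of the leaf. -/
theorem sigmaCompactSpace_leaf (hlie : ∀ A ∈ h, ∀ B ∈ h, A * B - B * A ∈ h)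
    (hA : ∀ q, IsLocalSection h p (A.proj q) (A.dom q) (A.sec q)) : SigmaCompactSpace A.Leaf := by
  have : ProperSpace h := FiniteDimensional.proper ℂ h
  refine ⟨expOrbitExhaustion A, fun n => ?_, ?_⟩
  · induction n with
    | zero => exact isCompact_singleton
    | succ n ih =>
      exact ((isCompact_closedBall _ _).prod ih).image (continuous_expAct hlie hA)
  · have hmono : Monotone (expOrbitExhaustion A) := by
      refine monotone_nat_of_le_succ fun n x hx => ?_
      -- The stages increase because `exp 0 = 1` keeps every point in place.
      refine ⟨(0, x), ⟨by simp, hx⟩, A.val_injective ?_⟩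
      rw [val_expAct]
      simp
    have key : ∀ x, ExpOrbit h p x → ∃ n, ∃ y ∈ expOrbitExhaustion A n, A.val y = x := by
      intro x hx
      induction hx with
      | refl => exact ⟨0, _, rfl, rfl⟩
      | @exp_apply B x hB _ ih =>
        obtain ⟨n, y, hy, rfl⟩ := ih
        obtain ⟨m, hm⟩ := exists_nat_ge ‖B‖
        -- Stage `max n m + 1` uses the ball of radius `max n m`, which contains `B`, and stage `max
        -- n m`, which contains `y`.
        refine ⟨max n m + 1, expAct A (⟨B, hB⟩, y), ⟨(⟨B, hB⟩, y), ⟨?_, hmono (le_max_left _ _) hy⟩, rfl⟩, rfl⟩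
        rw [mem_closedBall_zero_iff]
        exact hm.trans (by simp)
    refine Set.eq_univ_of_forall fun x => Set.mem_iUnion.mpr ?_
    obtain ⟨n, y, hy, hyx⟩ := key _ (A.val_mem x)
    exact ⟨n, A.val_injective hyx ▸ hy⟩

/-- Orbits of groups generated by exponentials of a Lie algebra of operators are immersed
submanifolds. -/
theorem isImmersedSubmanifold_expOrbit (hlie : ∀ A ∈ h, ∀ B ∈ h, A * B - B * A ∈ h)
    (hd : Module.finrank ℂ (infTangent h p) = d) :
    IsImmersedSubmanifold {x | ExpOrbit h p x} d := by
  obtain ⟨A, hA⟩ := exists_sectionAtlas hlie hd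
  have := sigmaCompactSpace_leaf hlie hA
  exact A.isImmersedSubmanifold

end

/-! ### Adjoint orbits in coordinates. -/

section
open NormedSpace

section trans
variable {E : Type*} [NormedAddCommGroup E] [NormedSpace ℂ E] {h : Submodule ℂ (E →L[ℂ] E)}

theorem ExpOrbit.trans {x y z : E} (hxy : ExpOrbit h x y) (hyz : ExpOrbit h y z) :
    ExpOrbit h x z := by
  induction hyz with
  | refl => exact hxy
  | exp_apply hA _ ih => exact ih.exp_apply hA

/-- Each step `exp A` is undone by `exp (-A)`, and `-A` is in `h`. Thus the orbit under products of
exponentials is already the orbit of the group they generate. -/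
theorem ExpOrbit.symm [CompleteSpace E] {x y : E} (hxy : ExpOrbit h x y) : ExpOrbit h y x := by
  induction hxy with
  | refl => exact .refl
  | @exp_apply A x hA _ ih =>
    have e : exp (-A) (exp A x) = x := by
      change (exp (-A) * exp A) x = x
      rw [exp_neg_mul_exp_of_complex]
      rfl
    have h1 : ExpOrbit h (exp A x) (exp (-A) (exp A x)) := ExpOrbit.refl.exp_apply (h.neg_mem hA)
    rw [e] at h1
    exact h1.trans ih

end trans

theorem exp_toLin'_apply {n : ℕ} (M : Matrix (Fin n) (Fin n) ℂ) (v : Fin n → ℂ) :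
    exp (LinearMap.toContinuousLinearMap (Matrix.toLin' M)) v = (exp M).mulVec v := by
  -- This norm is auxiliary. The passage from matrices to operators is a continuous algebra
  -- homomorphism, hence commutes with `exp`.
  let _ : NormedRing (Matrix (Fin n) (Fin n) ℂ) := Matrix.linftyOpNormedRing
  let _ : NormedAlgebra ℂ (Matrix (Fin n) (Fin n) ℂ) := Matrix.linftyOpNormedAlgebra
  let _ : NormedAlgebra ℚ (Matrix (Fin n) (Fin n) ℂ) := .restrictScalars ℚ ℂ _
  let _ : NormedAlgebra ℚ ((Fin n → ℂ) →L[ℂ] Fin n → ℂ) := .restrictScalars ℚ ℂ _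
  let Φ : Matrix (Fin n) (Fin n) ℂ →ₐ[ℂ] ((Fin n → ℂ) →L[ℂ] Fin n → ℂ) :=
    AlgHom.ofLinearMap (LinearMap.toContinuousLinearMap.toLinearMap ∘ₗ Matrix.toLin'.toLinearMap)
      (by ext; simp) (fun M N => by ext; simp)
  have hΦ : Continuous Φ := Φ.toLinearMap.continuous_of_finiteDimensional
  have h1 := map_exp Φ hΦ M
  have h2 : (Φ (exp M)) v = (exp M).mulVec v := Matrix.toLin'_apply _ _
  exact (congrArg (fun f => f v) h1).symm.trans h2

variable (L : Type) [LieRing L] [LieAlgebra ℂ L] [Module.Finite ℂ L]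

theorem coords_endExp (f : Module.End ℂ L) (v : L) : coords L (endExp L f v) =
    exp (LinearMap.toContinuousLinearMap
      ((coords L).toLinearMap ∘ₗ f ∘ₗ (coords L).symm.toLinearMap)) (coords L v) := by
  have h1 : (coords L).toLinearMap ∘ₗ f ∘ₗ (coords L).symm.toLinearMap =
      Matrix.toLin' (LinearMap.toMatrix (Module.finBasis ℂ L) (Module.finBasis ℂ L) f) := by
    ext1 i
    ext1
    simp only [LinearMap.comp_apply, Matrix.toLin'_apply]
    have := LinearMap.toMatrix_mulVec_repr (Module.finBasis ℂ L) (Module.finBasis ℂ L) f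
      ((coords L).symm (Pi.single i 1))
    change _ = Matrix.mulVec _ (LinearMap.single ℂ (fun _ => ℂ) i 1)
    have h2 : ((Module.finBasis ℂ L).repr ((coords L).symm (Pi.single i 1)) : Fin _ → ℂ)
        = Pi.single i 1 := (coords L).apply_symm_apply _
    rw [h2] at this
    exact this.symm
  rw [h1, exp_toLin'_apply]
  have := LinearMap.toMatrix_mulVec_repr (Module.finBasis ℂ L) (Module.finBasis ℂ L)
    (endExp L f) v
  rw [endExp, LinearMap.toMatrix_toLin] at this
  exact this.symm

theorem isUnit_endExp (f : Module.End ℂ L) : IsUnit (endExp L f) :=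
  (Matrix.isUnit_exp (LinearMap.toMatrix (Module.finBasis ℂ L) (Module.finBasis ℂ L) f)).map
    (Matrix.toLinAlgEquiv (Module.finBasis ℂ L))

/-- The adjoint representation in coordinates. -/
noncomputable def adCoords :
    L →ₗ[ℂ] (Fin (Module.finrank ℂ L) → ℂ) →L[ℂ] (Fin (Module.finrank ℂ L) → ℂ) :=
  LinearMap.toContinuousLinearMap.toLinearMap ∘ₗ (coords L).conj.toLinearMap ∘ₗ
    (LieAlgebra.ad ℂ L : L →ₗ[ℂ] Module.End ℂ L)

theorem adCoords_apply (x y : L) : adCoords L x (coords L y) = coords L ⁅x, y⁆ := by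
  change coords L ⁅x, (coords L).symm (coords L y)⁆ = _
  rw [LinearEquiv.symm_apply_apply]

theorem coords_endExp_ad (x v : L) :
    coords L (endExp L (LieAlgebra.ad ℂ L x) v) = exp (adCoords L x) (coords L v) :=
  coords_endExp L _ v

theorem adCoords_lie_mem : ∀ A ∈ LinearMap.range (adCoords L), ∀ B ∈ LinearMap.range (adCoords L),
    A * B - B * A ∈ LinearMap.range (adCoords L) := by
  rintro _ ⟨x, rfl⟩ _ ⟨y, rfl⟩
  refine ⟨⁅x, y⁆, ?_⟩
  ext1 v
  obtain ⟨v, rfl⟩ := (coords L).surjective v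
  change _ = adCoords L x (adCoords L y (coords L v)) - adCoords L y (adCoords L x (coords L v))
  simp only [adCoords_apply]
  rw [lie_lie, map_sub]

/-- This links the abstract adjoint group to `ExpOrbit`: in coordinates its generators are the
exponentials of the operators in the range of `adCoords`. -/
theorem coords_image_adjointOrbit (X : L) : coords L '' adjointOrbit L X =
    {y | ExpOrbit (LinearMap.range (adCoords L)) (coords L X) y} := by
  ext y
  constructor
  · rintro ⟨_, ⟨g, hg, rfl⟩, rfl⟩
    -- The base point must vary for the induction: in a product `g * g'` the factor `g` acts on a
    -- point already moved by `g'`.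
    suffices ∀ v, ExpOrbit (LinearMap.range (adCoords L)) (coords L v)
        (coords L ((g : Module.End ℂ L) v)) from this X
    induction hg using Subgroup.closure_induction with
    | mem g hg =>
      obtain ⟨x, hx⟩ := hg
      intro v
      rw [hx, coords_endExp_ad]
      exact ExpOrbit.refl.exp_apply ⟨x, rfl⟩
    | one => exact fun v => .refl
    | mul g g' _ _ hg hg' => exact fun v => (hg' v).trans (hg _)
    | inv g _ hg =>
      intro v
      have := (hg ((g⁻¹ : (Module.End ℂ L)ˣ).val v)).symm
      have e : (g : Module.End ℂ L) ((g⁻¹ : (Module.End ℂ L)ˣ).val v) = v := by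
        rw [← Module.End.mul_apply, Units.mul_inv]
        rfl
      rwa [e] at this
  · intro hy
    induction hy with
    | refl => exact ⟨X, ⟨1, one_mem _, rfl⟩, rfl⟩
    | exp_apply hA _ ih =>
      obtain ⟨x, rfl⟩ := hA
      obtain ⟨_, ⟨g, hg, rfl⟩, rfl⟩ := ih
      obtain ⟨u, hu⟩ := isUnit_endExp L (LieAlgebra.ad ℂ L x)
      refine ⟨_, ⟨u * g, mul_mem (Subgroup.subset_closure ⟨x, hu⟩) hg, rfl⟩, ?_⟩
      rw [← coords_endExp_ad, ← hu]
      rfl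

/-- The tangent space at `X` consists of the brackets `[x, X] = ad X (-x)`, so it is the image of
`ad X`. -/
theorem finrank_infTangent_adCoords (X : L) :
    Module.finrank ℂ (infTangent (LinearMap.range (adCoords L)) (coords L X)) =
      Module.finrank ℂ (LinearMap.range (LieAlgebra.ad ℂ L X)) := by
  suffices infTangent (LinearMap.range (adCoords L)) (coords L X) =
      (LinearMap.range (LieAlgebra.ad ℂ L X)).map (coords L).toLinearMap by
    rw [this]
    exact LinearEquiv.finrank_map_eq (coords L) _
  ext y
  constructor
  · rintro ⟨_, ⟨x, rfl⟩, rfl⟩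
    refine ⟨⁅x, X⁆, ⟨-x, by simp⟩, (adCoords_apply L x X).symm⟩
  · rintro ⟨_, ⟨x, rfl⟩, rfl⟩
    refine ⟨_, ⟨-x, rfl⟩, ?_⟩
    change adCoords L (-x) (coords L X) = _
    rw [adCoords_apply]
    simp

/-- Adjoint orbits are immersed submanifolds. -/
theorem isImmersedSubmanifold_adjointOrbit (X : L) :
    IsImmersedSubmanifold (coords L '' adjointOrbit L X)
      (Module.finrank ℂ (LinearMap.range (LieAlgebra.ad ℂ L X))) := by
  rw [coords_image_adjointOrbit]
  exact isImmersedSubmanifold_expOrbit (adCoords_lie_mem L) (finrank_infTangent_adCoords L X)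

end

/-! ### The rank of `ad X` on the Tits construction. -/

section
open RealNormedAlgebra

/-- The operator is block diagonal with blocks `0`, `f₂` and one copy of `f₃` for each index, so its
image is the product of the images of the blocks. -/
theorem finrank_range_of_block {K V V₁ V₂ V₃ ι : Type*} [Field K] [AddCommGroup V] [Module K V]
    [AddCommGroup V₁] [Module K V₁] [AddCommGroup V₂] [Module K V₂] [AddCommGroup V₃] [Module K V₃]
    [Fintype ι] [Module.Finite K V₂] [Module.Finite K V₃]
    (e : V ≃ₗ[K] V₁ × V₂ × (ι → V₃)) {f : V →ₗ[K] V} {f₂ : V₂ →ₗ[K] V₂} {f₃ : V₃ →ₗ[K] V₃}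
    (hf : ∀ v, e (f v) = (0, f₂ (e v).2.1, fun i => f₃ ((e v).2.2 i))) :
    Module.finrank K (LinearMap.range f) = Module.finrank K (LinearMap.range f₂) +
      Fintype.card ι * Module.finrank K (LinearMap.range f₃) := by
  let j : LinearMap.range f₂ × (ι → LinearMap.range f₃) →ₗ[K] V₁ × V₂ × (ι → V₃) :=
    (LinearMap.inr K V₁ (V₂ × (ι → V₃))) ∘ₗ
      (LinearMap.prodMap (LinearMap.range f₂).subtype
        (LinearMap.pi fun i => (LinearMap.range f₃).subtype ∘ₗ LinearMap.proj i))
  have hj : ∀ x, j x = (0, (x.1 : V₂), fun i => (x.2 i : V₃)) := fun x => rfl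
  have hinj : Function.Injective j := by
    intro x y hxy
    rw [hj, hj] at hxy
    simp only [Prod.mk.injEq, true_and] at hxy
    exact Prod.ext (Subtype.ext hxy.1) (funext fun i => Subtype.ext (congrFun hxy.2 i))
  have hrange : (LinearMap.range f).map e.toLinearMap = LinearMap.range j := by
    ext y
    constructor
    · rintro ⟨_, ⟨v, rfl⟩, rfl⟩
      exact ⟨(⟨_, ⟨_, rfl⟩⟩, fun i => ⟨_, ⟨_, rfl⟩⟩), (hf v).symm⟩
    · rintro ⟨⟨⟨_, ⟨a, rfl⟩⟩, c⟩, rfl⟩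
      choose w hw using fun i => (c i).2
      refine ⟨_, ⟨e.symm (0, a, w), rfl⟩, ?_⟩
      refine (hf _).trans ?_
      rw [LinearEquiv.apply_symm_apply, hj]
      simp only [hw]
  have h1 := LinearEquiv.finrank_map_eq e (LinearMap.range f)
  rw [← h1]
  refine (congrArg (fun S : Submodule K _ => Module.finrank K S) hrange).trans ?_
  rw [LinearMap.finrank_range_of_inj hinj, Module.finrank_prod, Module.finrank_pi_fintype]
  simp

variable (A : Type) [NonAssocRing A] [StarRing A] [Module ℝ A] [RealNormedAlgebra A]

/-- The imaginary part is the kernel of the surjective linear form `re`. -/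
theorem finrank_im : Module.finrank ℝ (Im A) + 1 = Module.finrank ℝ A := by
  have h1 : Im A = LinearMap.ker (re : A →ₗ[ℝ] ℝ) := by
    ext a
    exact re_eq_zero_iff a
  have h2 : LinearMap.range (re : A →ₗ[ℝ] ℝ) = ⊤ := by
    refine LinearMap.range_eq_top.mpr fun r => ⟨r • 1, ?_⟩
    rw [map_smul, re_one, smul_eq_mul, mul_one]
  have h3 := LinearMap.finrank_range_add_finrank_ker (re : A →ₗ[ℝ] ℝ)
  rw [h2, finrank_top, Module.finrank_self] at h3
  have h4 : Module.finrank ℝ (Im A) = Module.finrank ℝ (LinearMap.ker (re : A →ₗ[ℝ] ℝ)) :=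
    congrArg (fun S : Submodule ℝ A => Module.finrank ℝ S) h1
  rw [h4, add_comm]
  exact h3

theorem finrank_octonion : Module.finrank ℝ Octonion = 8 := by
  rw [Octonion.linearEquivProd.finrank_eq, Module.finrank_prod, Quaternion.finrank_eq_four]

variable (B : Type) [NonAssocRing B] [StarRing B] [Module ℝ B] [RealNormedAlgebra B]

/-- The complexified action of derivations on traceless Hermitian matrices. -/
noncomputable def derJ0Complex : ℂ ⊗[ℝ] DerJ B →ₗ[ℂ] Module.End ℂ (ℂ ⊗[ℝ] J30 B) :=
  (LinearMap.baseChangeHom ℝ ℂ (J30 B) (J30 B) ∘ₗ derJ0).liftBaseChange ℂ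

variable {B} in
theorem derJ0Complex_tmul (c z : ℂ) (d : DerJ B) (x : J30 B) :
    derJ0Complex B (c ⊗ₜ d) (z ⊗ₜ x) = (c * z) ⊗ₜ derJ0 d x := by
  simp [derJ0Complex, TensorProduct.smul_tmul']

/-- The decomposition of the Tits construction under `Der J3(B)`. -/
noncomputable def titsEquiv : Tits A B ≃ₗ[ℝ]
    DerA A × DerJ B × (Fin (Module.finrank ℝ (Im A)) → J30 B) :=
  Tits.linearEquivProd ≪≫ₗ LinearEquiv.prodAssoc ℝ _ _ _ ≪≫ₗ
    LinearEquiv.prodCongr (LinearEquiv.refl ℝ _) (LinearEquiv.prodCongr (LinearEquiv.refl ℝ _)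
      (TensorProduct.equivFinsuppOfBasisLeft (Module.finBasis ℝ (Im A)) ≪≫ₗ
        Finsupp.linearEquivFunOnFinite ℝ _ _))

variable {A B} in
-- An element of `Der J3(B)` has neither a `Der A` component nor a tensor component, so only its
-- bracket in `Der J3(B)` and its action on the second tensor factor remain. A basis of `Im A` turns
-- the latter into the same operator on each copy of `J30 B`.
theorem titsEquiv_lie (d : DerJ B) (t : Tits A B) : titsEquiv A B ⁅Tits.ofDerJ A B d, t⁆ =
    (0, ⁅d, (titsEquiv A B t).2.1⁆, fun i => derJ0 d ((titsEquiv A B t).2.2 i)) := by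
  have h1 : ⁅Tits.ofDerJ A B d, t⁆ = ⟨(0, ⁅d, t.der.2⁆), (derJ0 d).lTensor (Im A) t.tens⟩ := by
    ext1
    · simp [Tits.der_lie, Tits.ofDerJ]
    · simp [Tits.tens_lie, Tits.ofDerJ, Tits.act]
  rw [h1]
  refine Prod.ext rfl (Prod.ext rfl (funext fun i => ?_))
  change TensorProduct.equivFinsuppOfBasisLeft (Module.finBasis ℝ (Im A))
      ((derJ0 d).lTensor (Im A) t.tens) i =
    derJ0 d (TensorProduct.equivFinsuppOfBasisLeft (Module.finBasis ℝ (Im A)) t.tens i)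
  induction t.tens using TensorProduct.induction_on with
  | zero => simp
  | add u v hu hv => simp only [map_add, Finsupp.add_apply, hu, hv]
  | tmul a x => simp

/-- The decomposition of the complexified Tits construction under `Der J3(B)`. -/
noncomputable def titsEquivComplex : ℂ ⊗[ℝ] Tits A B ≃ₗ[ℂ]
    (ℂ ⊗[ℝ] DerA A) × (ℂ ⊗[ℝ] DerJ B) × (Fin (Module.finrank ℝ (Im A)) → ℂ ⊗[ℝ] J30 B) :=
  (titsEquiv A B).baseChange ℝ ℂ _ _ ≪≫ₗ TensorProduct.prodRight ℝ ℂ ℂ _ _ ≪≫ₗ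
    LinearEquiv.prodCongr (LinearEquiv.refl ℂ _) (TensorProduct.prodRight ℝ ℂ ℂ _ _ ≪≫ₗ
      LinearEquiv.prodCongr (LinearEquiv.refl ℂ _) (TensorProduct.piRight ℝ ℂ ℂ _))

variable {A B} in
theorem titsEquivComplex_tmul (z : ℂ) (t : Tits A B) : titsEquivComplex A B (z ⊗ₜ t) =
    (z ⊗ₜ (titsEquiv A B t).1, z ⊗ₜ (titsEquiv A B t).2.1,
      fun i => z ⊗ₜ (titsEquiv A B t).2.2 i) := by
  simp [titsEquivComplex]

variable {A B} in
-- Both sides are additive in `X` and in `Y`, so pure tensors suffice, where the real decomposition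
-- applies. A general `X` is not a multiple of a real derivation, so the real formula alone would
-- not be enough.
theorem titsEquivComplex_lie (X : ℂ ⊗[ℝ] DerJ B) (Y : ℂ ⊗[ℝ] Tits A B) :
    titsEquivComplex A B ⁅(Tits.ofDerJ A B).toLinearMap.baseChange ℂ X, Y⁆ =
      (0, LieAlgebra.ad ℂ (ℂ ⊗[ℝ] DerJ B) X (titsEquivComplex A B Y).2.1,
        fun i => derJ0Complex B X ((titsEquivComplex A B Y).2.2 i)) := by
  induction X using TensorProduct.induction_on with
  | zero => simp; rfl
  | add X X' hX hX' =>
    rw [map_add, add_lie, map_add, hX, hX', map_add, map_add]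
    simp only [Prod.mk_add_mk, LinearMap.add_apply, add_zero]
    rfl
  | tmul c d =>
    induction Y using TensorProduct.induction_on with
    | zero => simp; rfl
    | add Y Y' hY hY' =>
      rw [lie_add, map_add, hY, hY', map_add]
      simp only [Prod.mk_add_mk, Prod.snd_add, Prod.fst_add, add_zero, Prod.mk.injEq, true_and]
      exact ⟨(map_add _ _ _).symm, funext fun i => (map_add _ _ _).symm⟩
    | tmul z t =>
      rw [LinearMap.baseChange_tmul, LieAlgebra.ExtendScalars.bracket_tmul, titsEquivComplex_tmul,
        titsEquivComplex_tmul]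
      change (_ ⊗ₜ (titsEquiv A B ⁅Tits.ofDerJ A B d, t⁆).1,
        _ ⊗ₜ (titsEquiv A B ⁅Tits.ofDerJ A B d, t⁆).2.1,
        fun i => _ ⊗ₜ (titsEquiv A B ⁅Tits.ofDerJ A B d, t⁆).2.2 i) = _
      simp only [titsEquiv_lie, TensorProduct.tmul_zero, derJ0Complex_tmul]
      rfl

theorem finrank_range_ad_ofDerJ (X : ℂ ⊗[ℝ] DerJ B) :
    Module.finrank ℂ (LinearMap.range (LieAlgebra.ad ℂ (ℂ ⊗[ℝ] Tits A B)
      ((Tits.ofDerJ A B).toLinearMap.baseChange ℂ X))) =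
      Module.finrank ℂ (LinearMap.range (LieAlgebra.ad ℂ (ℂ ⊗[ℝ] DerJ B) X)) +
        Module.finrank ℝ (Im A) * Module.finrank ℂ (LinearMap.range (derJ0Complex B X)) := by
  have := finrank_range_of_block (titsEquivComplex A B)
    (f := LieAlgebra.ad ℂ (ℂ ⊗[ℝ] Tits A B) ((Tits.ofDerJ A B).toLinearMap.baseChange ℂ X))
    (f₂ := LieAlgebra.ad ℂ (ℂ ⊗[ℝ] DerJ B) X) (f₃ := derJ0Complex B X) (titsEquivComplex_lie X)
  rwa [Fintype.card_fin] at this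

theorem orbitHasDim (X : ℂ ⊗[ℝ] DerJ Octonion) : OrbitHasDim A X
    (Module.finrank ℂ (LinearMap.range (LieAlgebra.ad ℂ (ℂ ⊗[ℝ] DerJ Octonion) X)) +
        Module.finrank ℝ (Im A) * Module.finrank ℂ (LinearMap.range (derJ0Complex Octonion X))) := by
  rw [← finrank_range_ad_ofDerJ]
  exact isImmersedSubmanifold_adjointOrbit _ _

end

theorem proposition2p1 (X : ℂ ⊗[ℝ] DerJ Octonion) :
    ∃ (α β : ℤ) (d : ℕ → ℕ), (∀ a ∈ ({1, 2, 4, 8} : Set ℕ), (d a : ℤ) = α + β * a) ∧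
      OrbitHasDim ℝ X (d 1) ∧ OrbitHasDim ℂ X (d 2) ∧ OrbitHasDim ℍ[ℝ] X (d 4) ∧
      OrbitHasDim Octonion X (d 8) := by
  set r := Module.finrank ℂ (LinearMap.range (LieAlgebra.ad ℂ (ℂ ⊗[ℝ] DerJ Octonion) X)) with hr
  set s := Module.finrank ℂ (LinearMap.range (derJ0Complex Octonion X)) with hs
  -- Here `a - 1 = dim Im A`, and `r + (a - 1) s = (r - s) + s a`. The constant `r - s` is taken in
  -- `ℤ`, while `a - 1` is a truncated subtraction in `ℕ`, harmless because `a ≥ 1`.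
  refine ⟨r - s, s, fun a => r + (a - 1) * s, ?_, ?_, ?_, ?_, ?_⟩
  · intro a ha
    have ha : 1 ≤ a := by
      rcases ha with rfl | rfl | rfl | rfl <;> norm_num
    push_cast [Nat.cast_sub ha]
    ring
  · have h1 := finrank_im ℝ
    rw [Module.finrank_self] at h1
    have h2 : Module.finrank ℝ (Im ℝ) = 0 := by omega
    simpa only [h2] using orbitHasDim ℝ X
  · have h1 := finrank_im ℂ
    rw [Complex.finrank_real_complex] at h1
    have h2 : Module.finrank ℝ (Im ℂ) = 1 := by omega
    simpa only [h2] using orbitHasDim ℂ X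
  · have h1 := finrank_im ℍ[ℝ]
    rw [Quaternion.finrank_eq_four] at h1
    have h2 : Module.finrank ℝ (Im ℍ[ℝ]) = 3 := by omega
    simpa only [h2] using orbitHasDim ℍ[ℝ] X
  · have h1 := finrank_im Octonion
    rw [finrank_octonion] at h1
    have h2 : Module.finrank ℝ (Im Octonion) = 7 := by omega
    simpa only [h2] using orbitHasDim Octonion X
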